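/- Let $n\ge 1$, $N=2^n$. Unary iteration over $[0,N)$ for pairwise commuting self-inverse unitaries $U_0,\dots,U_{N-1}$ on a target system $H$ is the multiplexed operation $\sum_{x<N}|x\rangle\langle x|\otimes U_x$ on an $n$-qubit selection register and $H$. QROM is the case in which $U_x$ XORs a given data word $d_x\in\{0,1\}^w$ into a $w$-bit target register, i.e. $|x\rangle|t\rangle\mapsto|x\rangle|t\oplus d_x\rangle$. Circuits consist of X, CNOT and Toffoli gates and of the controlled operations controlled-$U_i$; the cost is the number of Toffoli gates (the controlled-$U_i$ are not counted; for QROM they are sequences of CNOTs). An ancilla is dirty if it starts in an arbitrary, possibly entangled, state and must be returned to that state. For $1\le k\le n$ let $K=2^k$. Consider the following circuit with $n$ dirty ancillae. The selection register is split into its $k$ most significant qubits (top) and the remaining $n-k$ qubits (bottom). For each $j\in[0,K)$ one dirty root ancilla is toggled if the top part equals $j$ (by a $k$-controlled NOT that borrows dirty qubits), a read over the $N/K$ values $i$ of the bottom part, controlled on the root ancilla and with the operations $U_{jN/K+i}$, is performed with $n-k$ further dirty ancillae, and the root ancilla is toggled back. Finally one more read of the same shape, controlled on the untoggled root ancilla,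 is performed, which has at index $i$ all the operations $U_{jN/K+i}$, $j\in[0,K)$. Each read is a depth-first traversal, without measurement, of either a balanced binary tree (every node branches into "if $\lnot C$ do $A$; if $C$ do $B$") or a skew tree (which replaces this by "do $A$; if $C$ do $A^{-1}B$"). Then, for explicit such circuits: 1. For every $1\le k\le n$ and both kinds of tree, the circuit implements unary iteration over $[0,N)$ for all such families $(U_x)$, and QROM for all data (there using only X, CNOT and Toffoli gates, with the same Toffoli cost), and restores all $n$ dirty ancillae, for every joint input state. 2. For every $1\le k\le n$ and both kinds of tree, its Toffoli cost is $(K+1)\cdot\mathrm{QROMDirtyCost}(N/K)+\mathcal{O}(K k)$, where $\mathrm{QROMDirtyCost}(M)$ is the Toffoli cost of one controlled dirty read over $M$ indices with that kind of tree, and the implied constant is absolute. 3. When the register is split into halves, $k=\lfloor n/2\rfloor$ or $k=\lceil n/2\rceil$ with $k\ge1$ (so $K=\sqrt N$ for even $n$), the Toffoli cost is $1.5N+\mathcal{O}(n\sqrt N)$ with balanced trees and $1.25N+\mathcal{O}(n\sqrt N)$ with skew trees, with an absolute implied constant. -/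

import Mathlib

universe u

/-- Gates on the wires `W`. `op c i` applies the `i`-th indexed operation to the target system,
controlled on the wire `c`. -/
inductive Gate (W ι : Type) : Type where
  | x (t : W)
  | cnot (c t : W)
  | toffoli (c₁ c₂ t : W)
  | op (c : W) (i : ι)

/-- A circuit is a list of gates; the head of the list is applied first. -/
abbrev Circuit (W ι : Type) := List (Gate W ι)

/-- The operands of every gate are distinct. -/
def Gate.WellFormed {W ι : Type} : Gate W ι → Prop
  | .x _ => True
  | .cnot c t => c ≠ t
  | .toffoli c₁ c₂ t => c₁ ≠ c₂ ∧ c₁ ≠ t ∧ c₂ ≠ t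
  | .op _ _ => True

def Circuit.WellFormed {W ι : Type} (C : Circuit W ι) : Prop :=
  ∀ g ∈ C, g.WellFormed

def Gate.isToffoli {W ι : Type} : Gate W ι → Bool
  | .toffoli _ _ _ => true
  | _ => false

/-- The Toffoli cost. -/
def Circuit.toffoliCount {W ι : Type} (C : Circuit W ι) : ℕ :=
  C.countP Gate.isToffoli

/-- States of qubits `W` together with a target system `H`: the vector `∑ s, |s⟩ ⊗ ψ s` is given
by its `H`-valued amplitudes. -/
abbrev QState (W : Type) (H : Type u) := (W → Bool) → H

section Semantics

variable {W ι : Type} [DecidableEq W]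
variable {H : Type u} [NormedAddCommGroup H] [InnerProductSpace ℂ H]

/-- The action of a gate on states. The gates `x`, `cnot`, `toffoli` permute the basis states by an
involution (for distinct operands), so the new amplitude at `s` is the old one at the image of
`s`. -/
noncomputable def Gate.apply (U : ι → (H ≃ₗᵢ[ℂ] H)) (g : Gate W ι) (ψ : QState W H) :
    QState W H :=
  match g with
  | .x t => fun s => ψ (Function.update s t (!(s t)))
  | .cnot c t => fun s => ψ (Function.update s t (xor (s t) (s c)))
  | .toffoli c₁ c₂ t => fun s => ψ (Function.update s t (xor (s t) (s c₁ && s c₂)))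
  | .op c i => fun s => if s c then U i (ψ s) else ψ s

noncomputable def Circuit.run (U : ι → (H ≃ₗᵢ[ℂ] H)) (C : Circuit W ι) (ψ : QState W H) :
    QState W H :=
  C.foldl (fun φ g => g.apply U φ) ψ

end Semantics

section Constructions

variable {W ι : Type}

/-- Apply the operations with the listed labels, all controlled on `c`. -/
def load (c : W) (labels : List ι) : Circuit W ι :=
  labels.map (fun i => Gate.op c i)

/-- A Toffoli ladder. It flips `t` when all the controls are on; the borrowed wires below `t` are
left toggled. -/
def mcxLadder : (controls borrowed : List W) → (t : W) → Circuit W ι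
  | [], _, t => [.x t]
  | [c], _, t => [.cnot c t]
  | [c₁, c₂], _, t => [.toffoli c₁ c₂ t]
  | c :: cs, g :: gs, t => [.toffoli c g t] ++ mcxLadder cs gs g ++ [.toffoli c g t]
  | _, [], _ => []

/-- The multiply controlled NOT with dirty borrowed wires (at least two fewer than controls), by
laddered toggle detection: `4 k - 8` Toffolis for `k ≥ 3` controls. -/
def mcx (controls borrowed : List W) (t : W) : Circuit W ι :=
  match controls, borrowed with
  | c₁ :: c₂ :: c₃ :: cs, g :: gs =>
    mcxLadder (c₁ :: c₂ :: c₃ :: cs) (g :: gs) t ++ mcxLadder (c₂ :: c₃ :: cs) gs g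
  | cs, gs => mcxLadder cs gs t

/-- Traversal of a balanced binary tree, at a node whose incoming edge is stored in `c`, while `b`
stores `c ∧ y` for the selection bit `y` of that node. `vars` are the selection bits below the
node, most significant first, `anc` the ancillae for the levels below it, and `p` the number formed
by the selection bits above the node. A leaf node serves the two indices `2 p` and `2 p + 1`. DOWN,
BOUNCE and UP moves cost one Toffoli each, leaves none. -/
def balancedVisit (lab : ℕ → List ι) (c b : W) : (vars anc : List W) → (p : ℕ) → Circuit W ι
  | [], _, p =>
    [.cnot c b] ++ load b (lab (2 * p)) ++ [.cnot c b] ++ load b (lab (2 * p + 1))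
  | z :: vars, e :: anc, p =>
    [.cnot c b, .toffoli b z e] ++
      balancedVisit lab b e vars anc (2 * p) ++
      [.toffoli c z e, .cnot c b] ++
      balancedVisit lab b e vars anc (2 * p + 1) ++
      [.toffoli b z e]
  | _ :: _, [], _ => []

/-- Read controlled on `c` with a balanced tree: for clean ancillae, apply the operations with
labels `lab i` where `i` is the number in the register `sel` (least significant wire first).
One ancilla per wire of `sel` is used, and its initial value is restored. -/
def balancedRead (lab : ℕ → List ι) (c : W) (sel anc : List W) : Circuit W ι :=
  match sel.reverse, anc with
  | [], _ => load c (lab 0)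
  | y :: vars, b :: anc =>
    [.toffoli c y b] ++ balancedVisit lab c b vars anc 0 ++ [.toffoli c y b]
  | _ :: _, [] => []

/-- The labels at node `j` of the skew tree: those of all `i ≤ j` whose binary digits are contained
in the binary digits of `j`. -/
def skewLabels (lab : ℕ → List ι) (j : ℕ) : List ι :=
  ((List.range (j + 1)).filter (fun i => i &&& j == i)).flatMap lab

/-- The outputs `2 q` and `2 q + 1` of the skew tree, at a node that is stored in `w`, with the
least significant selection bit `z`. The second one is detected by toggling `f` once. -/
def skewNode (lab : ℕ → List ι) (z f w : W) (q : ℕ) : Circuit W ι :=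
  load w (skewLabels lab (2 * q)) ++ load f (skewLabels lab (2 * q + 1)) ++
    [.toffoli w z f] ++ load f (skewLabels lab (2 * q + 1))

/-- Traversal of a skew tree: as `balancedVisit`, but the left branch is entered unconditionally,
that is, with control `c` in place of `c ∧ ¬ y`, and every node has outputs. -/
def skewVisit (lab : ℕ → List ι) (z f c b : W) : (vars anc : List W) → (p : ℕ) → Circuit W ι
  | [], _, p => skewNode lab z f c (2 * p) ++ skewNode lab z f b (2 * p + 1)
  | y :: vars, e :: anc, p =>
    [.toffoli c y e] ++
      skewVisit lab z f c e vars anc (2 * p) ++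
      [.cnot c b, .toffoli b y e, .cnot c b] ++
      skewVisit lab z f b e vars anc (2 * p + 1) ++
      [.toffoli b y e]
  | _ :: _, [], _ => []

/-- Read controlled on `c` with a skew tree; the conventions are those of `balancedRead`. Each of
the nodes toggles `f` once, and the accumulated toggle of `f` is undone by one multiply controlled
NOT at the end. -/
def skewRead (lab : ℕ → List ι) (c : W) (sel anc : List W) : Circuit W ι :=
  match sel, anc with
  | [], _ => load c (skewLabels lab 0)
  | _ :: _, [] => []
  | z :: rest, f :: anc =>
    match rest.reverse, anc with
    | [], _ => skewNode lab z f c 0 ++ [.toffoli c z f]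
    | _ :: _, [] => []
    | y :: vars, e :: anc =>
      [.toffoli c y e] ++ skewVisit lab z f c e vars anc 0 ++
        [.cnot c e] ++ vars.map Gate.x ++
        mcx (e :: z :: vars) anc f ++
        vars.map Gate.x ++ [.cnot c e] ++
        [.toffoli c y e]

inductive TreeShape : Type where
  | balanced
  | skew

def treeRead (τ : TreeShape) (lab : ℕ → List ι) (c : W) (sel anc : List W) : Circuit W ι :=
  match τ with
  | .balanced => balancedRead lab c sel anc
  | .skew => skewRead lab c sel anc

/-- Flip `root` when the register `top` (least significant wire first) holds the number `j`,
borrowing dirty wires. -/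
def toggleOn (top borrowed : List W) (root : W) (j : ℕ) : Circuit W ι :=
  let flips : Circuit W ι :=
    (top.zipIdx.filter (fun q => !(j.testBit q.2))).map (fun q => Gate.x q.1)
  flips ++ mcx top borrowed root ++ flips

end Constructions

/-- `n` selection qubits (qubit `q` has weight `2 ^ q`) and `n` dirty ancilla qubits. -/
inductive Wire (n : ℕ) : Type where
  | sel (q : Fin n)
  | anc (q : Fin n)
  deriving DecidableEq

/-- Unary iteration over `[0, 2 ^ n)` with `n` dirty ancillae. The top part of the selection
register consists of the `k` most significant qubits, and there are `K = 2 ^ k` iterations on it;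
iteration `j` toggles a root ancilla on `j`, reads the bottom `n - k` qubits with the tree `τ`, and
toggles the root back. One more read, with an untoggled root, loads at index `i` the operations that
the `K` trees have at `i`. -/
def dirtyUnaryIteration (τ : TreeShape) (n k : ℕ) : Circuit (Wire n) ℕ :=
  let sel := (List.finRange n).map Wire.sel
  let bottom := sel.take (n - k)
  let top := sel.drop (n - k)
  match (List.finRange n).map Wire.anc with
  | [] => []
  | root :: anc =>
    (List.range (2 ^ k)).flatMap (fun j =>
      toggleOn top anc root j ++
        treeRead τ (fun i => [j * 2 ^ (n - k) + i]) root bottom anc ++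
        toggleOn top anc root j) ++
    treeRead τ (fun i => (List.range (2 ^ k)).map (fun j => j * 2 ^ (n - k) + i)) root bottom anc

/-- The Toffoli cost of one controlled dirty read over `2 ^ m` indices with `m` ancillae (the
control is ancilla `0`). -/
def dirtyReadCost (τ : TreeShape) (m : ℕ) : ℕ :=
  Circuit.toffoliCount (treeRead (W := Wire (m + 1)) (ι := ℕ) τ (fun i => [i]) (Wire.anc 0)
    ((List.finRange m).map (fun q => Wire.sel q.castSucc))
    ((List.finRange m).map (fun q => Wire.anc q.succ)))

/-- In a QROM the indexed operation `i` XORs the word `data i` into a `w`-bit target register, so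
that its controlled version is a sequence of CNOTs. -/
def Gate.toQROM {W : Type} {w : ℕ} (data : ℕ → Fin w → Bool) :
    Gate W ℕ → Circuit (W ⊕ Fin w) Empty
  | .x t => [.x (.inl t)]
  | .cnot c t => [.cnot (.inl c) (.inl t)]
  | .toffoli c₁ c₂ t => [.toffoli (.inl c₁) (.inl c₂) (.inl t)]
  | .op c i =>
    ((List.finRange w).filter (fun r => data i r)).map (fun r => Gate.cnot (.inl c) (.inr r))

/-- The QROM with `n` dirty ancillae, a circuit of X, CNOT and Toffoli gates only. -/
def dirtyQROM (τ : TreeShape) (n k : ℕ) {w : ℕ} (data : ℕ → Fin w → Bool) :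
    Circuit (Wire n ⊕ Fin w) Empty :=
  (dirtyUnaryIteration τ n k).flatMap (Gate.toQROM data)

/-! The gates other than `op` permute basis states, so the amplitude at a final basis state `s` is
followed back along a single path. `Circuit.pull` is the start of that path and `Circuit.labels` the
list of operations met on it (`run_apply`). For commuting involutions only the parity of each
label's multiplicity matters. It is tested with weights `w : ι → Bool`: `Circuit.emit w` is the sum
over 𝔽₂ of the weights met. A circuit acts as `U i` at `s` once `pull` fixes `s` and `emit w` equals
`w i` for all `w` (`run_eq_of_emit_eq`). With `w` a bit position of the data words, the same
identity gives the QROM.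

With dirty ancillae a single read applies uncontrolled garbage, but the garbage is reproducible: two
runs that differ only in the control emit weights that differ by exactly `w` of the selected index
(`emit_treeRead_update`). Write `E_j(s)` for what tree `j` emits with the root untoggled. Block `j`
then emits `E_j(s) + [top = j] · w(j · 2^(n-k) + bottom)`. As `emit` is additive in the weight, the
last read emits `∑_j E_j(s)`, which removes all the garbage and leaves the weight of the selected
index (`emit_splitIteration`).

The difference property is proved by induction on the tree, for two states that differ on the two
edge wires of a node: over 𝔽₂ the emitted difference is linear in the differences of these wires,
and the unknown ancilla values cancel (`emit_balancedVisit_xor`, `emit_skewVisit_xor`). The skew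
tree visits all `j` whose digits are contained in those of the selected `x`, and outputs at `j` the
sum of `w` over all `i` contained in `j`. The total is `w x` by Möbius inversion mod 2
(`skewTraverse_skewSum`).

Both traversals satisfy `V(l+1) = 2 V(l) + 3`, with `V(0) = 0` for the balanced and `V(0) = 2` for
the skew tree. This gives the leading constants `3/2` and `5/4`. The multiply controlled NOTs are
linear in their number of controls and enter only the error terms. -/

/-! ### Parities of lists and products of commuting involutions. -/

/-- The parity of a list of Booleans. -/
def xorSum (L : List Bool) : Bool := L.foldr xor false

@[simp] theorem xorSum_nil : xorSum [] = false := rfl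

@[simp] theorem xorSum_cons (a : Bool) (L : List Bool) : xorSum (a :: L) = xor a (xorSum L) := rfl

@[simp] theorem xorSum_append (L M : List Bool) :
    xorSum (L ++ M) = xor (xorSum L) (xorSum M) := by
  induction L with
  | nil => simp
  | cons a L ih => simp [ih]

theorem xorSum_map_xor {α : Type*} (L : List α) (f g : α → Bool) :
    xorSum (L.map fun a => xor (f a) (g a)) = xor (xorSum (L.map f)) (xorSum (L.map g)) := by
  induction L with
  | nil => rfl
  | cons a L ih => simp only [List.map_cons, xorSum_cons, ih, Bool.xor_assoc, Bool.xor_left_comm]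

theorem xorSum_map_false {α : Type*} (L : List α) : xorSum (L.map fun _ => false) = false := by
  induction L with
  | nil => rfl
  | cons a L ih => simpa using ih

theorem xorSum_map_range_single (K t : ℕ) (g : ℕ → Bool) :
    xorSum ((List.range K).map fun j => decide (t = j) && g j) = (decide (t < K) && g t) := by
  induction K with
  | zero => simp
  | succ K ih =>
    simp only [List.range_succ, List.map_append, xorSum_append, ih, List.map_cons, List.map_nil,
      xorSum_cons, xorSum_nil, Bool.xor_false]
    rcases lt_trichotomy t K with h | h | h
    · simp [h, h.ne, Nat.lt_succ_of_lt h]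
    · simp [h]
    · simp [h.ne', not_lt.2 h.le, show ¬ t < K + 1 by omega]

theorem xorSum_map_beq {α : Type*} [DecidableEq α] (L : List α) (x : α) :
    xorSum (L.map fun a => a == x) = decide (Odd (L.count x)) := by
  induction L with
  | nil => simp
  | cons a L ih =>
    by_cases h : a = x
    · simp only [List.map_cons, xorSum_cons, ih, h, beq_self_eq_true, List.count_cons_self,
        Nat.odd_add_one, Bool.true_xor, decide_not]
    · simp [ih, beq_false_of_ne h, List.count_cons_of_ne h]

/-- A product of commuting involutions, given by a list in which only one of the labels occurs an
odd number of times, is the involution with this label. -/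
theorem prod_map_eq_of_odd_count_iff {ι G : Type*} [DecidableEq ι] [CommGroup G] (u : ι → G)
    (hu : ∀ i, u i * u i = 1) (L : List ι) (i : ι) (h : ∀ x, Odd (L.count x) ↔ x = i) :
    (L.map u).prod = u i := by
  rw [Finset.prod_list_map_count, Finset.prod_eq_single i]
  · obtain ⟨m, hm⟩ := (h i).2 rfl
    rw [hm, pow_succ, pow_mul, pow_two, hu, one_pow, one_mul]
  · intro x _ hx
    have : Even (L.count x) := by
      rw [← Nat.not_odd_iff_even, h]; exact hx
    obtain ⟨m, hm⟩ := this
    rw [hm, ← two_mul, pow_mul, pow_two, hu, one_pow]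
  · intro hi
    have := (h i).2 rfl
    rw [List.mem_toFinset] at hi
    simp [List.count_eq_zero_of_not_mem hi] at this

/-- The subgroup generated by pairwise commuting elements is commutative, so the computation can be
done there and mapped back. -/
theorem prod_map_eq_of_commute {ι G : Type*} [DecidableEq ι] [Group G] (u : ι → G) (S : Set ι)
    (hu : ∀ i ∈ S, u i * u i = 1) (hc : ∀ i ∈ S, ∀ j ∈ S, u i * u j = u j * u i)
    (L : List ι) (hL : ∀ x ∈ L, x ∈ S) (i : ι) (h : ∀ x, Odd (L.count x) ↔ x = i) :
    (L.map u).prod = u i := by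
  classical
  have hi : i ∈ S := hL i (List.count_pos_iff.1 ((h i).2 rfl).pos)
  have := Subgroup.isMulCommutative_closure (k := u '' S) (by
    rintro _ ⟨a, ha, rfl⟩ _ ⟨b, hb, rfl⟩
    exact hc a ha b hb)
  let _ : CommGroup (Subgroup.closure (u '' S)) :=
    { (inferInstance : Group (Subgroup.closure (u '' S))) with
      mul_comm := this.is_comm.comm }
  -- The value `1` outside `S` keeps `v` involutive everywhere; no label of `L` reaches it.
  let v : ι → Subgroup.closure (u '' S) := fun a =>
    if ha : a ∈ S then ⟨u a, Subgroup.subset_closure ⟨a, ha, rfl⟩⟩ else 1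
  have hv : ∀ a ∈ S, (v a : G) = u a := fun a ha => by simp [v, ha]
  have key := prod_map_eq_of_odd_count_iff v (fun a => by
    by_cases ha : a ∈ S
    · simp only [v, ha, dite_true]; exact Subtype.ext (hu a ha)
    · simp only [v, ha, dite_false]; exact mul_one 1) L i h
  have key' := congrArg (Subgroup.subtype _) key
  rw [map_list_prod, List.map_map] at key'
  have : L.map (⇑(Subgroup.subtype (Subgroup.closure (u '' S))) ∘ v) = L.map u :=
    List.map_congr_left fun a ha => hv a (hL a ha)
  rw [this] at key'
  exact key'.trans (hv i hi)

/-! ### Following basis states backwards through a circuit. -/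

section BasisSemantics

variable {W ι : Type} [DecidableEq W]

/-- The basis state that a gate takes to `s`. -/
def Gate.pull : Gate W ι → (W → Bool) → W → Bool
  | .x t, s => Function.update s t (!(s t))
  | .cnot c t, s => Function.update s t (xor (s t) (s c))
  | .toffoli c₁ c₂ t, s => Function.update s t (xor (s t) (s c₁ && s c₂))
  | .op _ _, s => s

/-- The labels of the operations that a gate applies at the basis state `s`. -/
def Gate.labels : Gate W ι → (W → Bool) → List ι
  | .op c i, s => if s c then [i] else []
  | _, _ => []

/-- The basis state that a circuit takes to `s`. -/
def Circuit.pull : Circuit W ι → (W → Bool) → W → Bool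
  | [], s => s
  | g :: C, s => g.pull (Circuit.pull C s)

/-- The labels of the operations that a circuit applies on its way to the basis state `s`, last one
first. -/
def Circuit.labels : Circuit W ι → (W → Bool) → List ι
  | [], _ => []
  | g :: C, s => Circuit.labels C s ++ g.labels (Circuit.pull C s)

/-- The parity of the weights of the labels that are applied. -/
def Circuit.emit (w : ι → Bool) (C : Circuit W ι) (s : W → Bool) : Bool :=
  xorSum ((Circuit.labels C s).map w)

namespace Circuit

@[simp] theorem pull_nil (s : W → Bool) : pull ([] : Circuit W ι) s = s := rfl

@[simp] theorem pull_cons (g : Gate W ι) (C : Circuit W ι) (s : W → Bool) :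
    pull (g :: C) s = g.pull (pull C s) := rfl

@[simp] theorem pull_append (C D : Circuit W ι) (s : W → Bool) :
    pull (C ++ D) s = pull C (pull D s) := by
  induction C with
  | nil => rfl
  | cons g C ih => exact congrArg g.pull ih

theorem labels_append (C D : Circuit W ι) (s : W → Bool) :
    labels (C ++ D) s = labels D s ++ labels C (pull D s) := by
  induction C with
  | nil => simp [labels]
  | cons g C ih => simp [labels, ih]

@[simp] theorem emit_nil (w : ι → Bool) (s : W → Bool) : emit w ([] : Circuit W ι) s = false := rfl

@[simp] theorem emit_append (w : ι → Bool) (C D : Circuit W ι) (s : W → Bool) :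
    emit w (C ++ D) s = xor (emit w D s) (emit w C (pull D s)) := by
  simp [emit, labels_append]

theorem emit_cons (w : ι → Bool) (g : Gate W ι) (C : Circuit W ι) (s : W → Bool) :
    emit w (g :: C) s = xor (emit w C s) (xorSum ((g.labels (pull C s)).map w)) := by
  simp [emit, labels]

@[simp] theorem emit_cons_x (w : ι → Bool) (t : W) (C : Circuit W ι) (s : W → Bool) :
    emit w (.x t :: C) s = emit w C s := by simp [emit_cons, Gate.labels]

@[simp] theorem emit_cons_cnot (w : ι → Bool) (c t : W) (C : Circuit W ι) (s : W → Bool) :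
    emit w (.cnot c t :: C) s = emit w C s := by simp [emit_cons, Gate.labels]

@[simp] theorem emit_cons_toffoli (w : ι → Bool) (c₁ c₂ t : W) (C : Circuit W ι) (s : W → Bool) :
    emit w (.toffoli c₁ c₂ t :: C) s = emit w C s := by simp [emit_cons, Gate.labels]

@[simp] theorem emit_cons_op (w : ι → Bool) (c : W) (i : ι) (C : Circuit W ι) (s : W → Bool) :
    emit w (.op c i :: C) s = xor (emit w C s) (pull C s c && w i) := by
  by_cases h : pull C s c <;> simp [emit_cons, Gate.labels, h]

@[simp] theorem pull_load (c : W) (L : List ι) (s : W → Bool) : pull (load c L) s = s := by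
  induction L with
  | nil => rfl
  | cons i L ih => simpa [load, Gate.pull] using ih

@[simp] theorem emit_load (w : ι → Bool) (c : W) (L : List ι) (s : W → Bool) :
    emit w (load c L) s = (s c && xorSum (L.map w)) := by
  induction L with
  | nil => simp [load]
  | cons i L ih =>
    have h := pull_load c L s
    simp only [load] at h ih ⊢
    simp only [List.map_cons, emit_cons_op, ih, h, xorSum_cons]
    grind

/-- Additivity in the weight: one read carrying the operations of all trees emits the sum of what
the separate trees emit from the same state. -/
theorem emit_xorSum {κ : Type*} (J : List κ) (w : κ → ι → Bool) (C : Circuit W ι) (s : W → Bool) :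
    emit (fun i => xorSum (J.map fun j => w j i)) C s = xorSum (J.map fun j => emit (w j) C s) := by
  simp only [emit]
  induction labels C s with
  | nil => exact (xorSum_map_false J).symm
  | cons i L ih => simp [ih, xorSum_map_xor]

theorem pull_flatMap_of_pull_eq {κ : Type*} (J : List κ) (f : κ → Circuit W ι)
    (h : ∀ j ∈ J, ∀ s, pull (f j) s = s) (s : W → Bool) : pull (J.flatMap f) s = s := by
  induction J with
  | nil => rfl
  | cons j J ih => simp_all

theorem emit_flatMap_of_pull_eq {κ : Type*} (J : List κ) (f : κ → Circuit W ι)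
    (h : ∀ j ∈ J, ∀ s, pull (f j) s = s) (w : ι → Bool) (s : W → Bool) :
    emit w (J.flatMap f) s = xorSum (J.map fun j => emit w (f j) s) := by
  induction J with
  | nil => rfl
  | cons j J ih =>
    have h' : ∀ j ∈ J, ∀ s, pull (f j) s = s := fun i hi => h i (List.mem_cons_of_mem _ hi)
    simp [ih h', pull_flatMap_of_pull_eq J f h', Bool.xor_comm]

theorem mem_of_mem_labels {C : Circuit W ι} {s : W → Bool} {i : ι} (h : i ∈ labels C s) :
    ∃ c, Gate.op c i ∈ C := by
  induction C with
  | nil => simp [labels] at h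
  | cons g C ih =>
    rcases List.mem_append.1 h with h | h
    · obtain ⟨c, hc⟩ := ih h
      exact ⟨c, List.mem_cons_of_mem _ hc⟩
    · cases g with
      | op c j =>
        by_cases hc : pull C s c
        · simp [Gate.labels, hc] at h
          exact ⟨c, by simp [h]⟩
        · simp [Gate.labels, hc] at h
      | _ => simp [Gate.labels] at h

/-- Each gate sends the amplitude at its `pull` to `s`, up to the operation it applies there. This
is how `Gate.apply` is defined, so distinct operands play no role yet. -/
theorem run_apply {H : Type u} [NormedAddCommGroup H] [InnerProductSpace ℂ H]
    (U : ι → (H ≃ₗᵢ[ℂ] H)) (C : Circuit W ι) (ψ : QState W H) (s : W → Bool) :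
    C.run U ψ s = ((labels C s).map U).prod (ψ (pull C s)) := by
  induction C generalizing ψ with
  | nil => rfl
  | cons g C ih =>
    have : Circuit.run U (g :: C) ψ s = Circuit.run U C (g.apply U ψ) s := rfl
    rw [this, ih]
    cases g with
    | op c i =>
      by_cases h : pull C s c <;> simp [labels, Gate.labels, Gate.apply, Gate.pull, h]
    | _ => simp [labels, Gate.labels, Gate.apply, Gate.pull]

/-- If every weight sees only the label `i`, then commuting involutions act as the `i`-th one. -/
theorem run_eq_of_emit_eq [DecidableEq ι] {H : Type u} [NormedAddCommGroup H]
    [InnerProductSpace ℂ H] (U : ι → (H ≃ₗᵢ[ℂ] H)) (S : Set ι)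
    (hU : ∀ i ∈ S, U i * U i = 1) (hc : ∀ i ∈ S, ∀ j ∈ S, U i * U j = U j * U i)
    (C : Circuit W ι) (hC : ∀ c i, Gate.op c i ∈ C → i ∈ S) (s : W → Bool) (i : ι)
    (hpull : pull C s = s) (hemit : ∀ w, emit w C s = w i) (ψ : QState W H) :
    C.run U ψ s = U i (ψ s) := by
  rw [run_apply, hpull, prod_map_eq_of_commute U S hU hc _ _ i]
  · intro x
    -- The indicator weight of `x` turns the emitted parity into the parity of the multiplicity of
    -- `x`.
    have := hemit (fun a => a == x)
    rw [emit, xorSum_map_beq] at this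
    rw [← decide_eq_true_iff (p := Odd _), this, beq_iff_eq, eq_comm]
  · intro x hx
    obtain ⟨c, hc⟩ := mem_of_mem_labels hx
    exact hC c x hc

end Circuit

/-! ### Reduction to reads with one label per index. -/

/-- Replace the operation `i` by the operations with labels `lab i`. -/
def Gate.relabel (lab : ℕ → List ι) : Gate W ℕ → Circuit W ι
  | .x t => [.x t]
  | .cnot c t => [.cnot c t]
  | .toffoli c₁ c₂ t => [.toffoli c₁ c₂ t]
  | .op c i => load c (lab i)

namespace Circuit

theorem pull_flatMap_relabel (lab : ℕ → List ι) (C : Circuit W ℕ) (s : W → Bool) :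
    pull (C.flatMap (Gate.relabel lab)) s = pull C s := by
  induction C with
  | nil => rfl
  | cons g C ih => cases g <;> simp [Gate.relabel, ih, Gate.pull]

theorem emit_flatMap_relabel (lab : ℕ → List ι) (w : ι → Bool) (C : Circuit W ℕ) (s : W → Bool) :
    emit w (C.flatMap (Gate.relabel lab)) s = emit (fun i => xorSum ((lab i).map w)) C s := by
  induction C with
  | nil => rfl
  | cons g C ih => cases g <;> simp [Gate.relabel, ih, pull_flatMap_relabel]

end Circuit

end BasisSemantics

section Relabel

variable {W ι : Type}

namespace Circuit

@[simp] theorem wellFormed_nil : WellFormed ([] : Circuit W ι) := by simp [WellFormed]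

@[simp] theorem wellFormed_cons (g : Gate W ι) (C : Circuit W ι) :
    WellFormed (g :: C) ↔ g.WellFormed ∧ WellFormed C := by simp [WellFormed]

@[simp] theorem wellFormed_append (C D : Circuit W ι) :
    WellFormed (C ++ D) ↔ WellFormed C ∧ WellFormed D := by
  simp only [WellFormed, List.mem_append]
  exact ⟨fun h => ⟨fun g hg => h g (.inl hg), fun g hg => h g (.inr hg)⟩,
    fun h g hg => hg.elim (h.1 g) (h.2 g)⟩

@[simp] theorem wellFormed_load (c : W) (L : List ι) : WellFormed (load c L) := by
  simp [WellFormed, load, Gate.WellFormed]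

theorem wellFormed_flatMap {κ : Type*} (J : List κ) (f : κ → Circuit W ι) :
    WellFormed (J.flatMap f) ↔ ∀ j ∈ J, WellFormed (f j) := by
  induction J with
  | nil => simp
  | cons j J ih => simp [ih]

@[simp] theorem toffoliCount_nil : toffoliCount ([] : Circuit W ι) = 0 := rfl

@[simp] theorem toffoliCount_append (C D : Circuit W ι) :
    toffoliCount (C ++ D) = toffoliCount C + toffoliCount D := by
  simp [toffoliCount]

@[simp] theorem toffoliCount_cons (g : Gate W ι) (C : Circuit W ι) :
    toffoliCount (g :: C) = toffoliCount C + if g.isToffoli then 1 else 0 := by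
  simp [toffoliCount, List.countP_cons]

@[simp] theorem toffoliCount_load (c : W) (L : List ι) : toffoliCount (load c L) = 0 := by
  simp [toffoliCount, load, Gate.isToffoli]

@[simp] theorem toffoliCount_map_x {κ : Type*} (f : κ → W) (L : List κ) :
    toffoliCount (L.map fun a => (Gate.x (f a) : Gate W ι)) = 0 := by
  simp [toffoliCount, Gate.isToffoli]

@[simp] theorem wellFormed_map_x {κ : Type*} (f : κ → W) (L : List κ) :
    WellFormed (L.map fun a => (Gate.x (f a) : Gate W ι)) := by
  simp [WellFormed, Gate.WellFormed]

end Circuit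

theorem load_flatMap_relabel (lab : ℕ → List ι) (c : W) (L : List ℕ) :
    (load c L).flatMap (Gate.relabel lab) = load c (L.flatMap lab) := by
  induction L with
  | nil => rfl
  | cons i L ih => simp_all [load, Gate.relabel]

theorem skewLabels_eq_flatMap (lab : ℕ → List ι) (j : ℕ) :
    skewLabels lab j = (skewLabels (fun i => [i]) j).flatMap lab := by
  simp [skewLabels]

theorem mcxLadder_flatMap_relabel (lab : ℕ → List ι) (cs gs : List W) (t : W) :
    (mcxLadder cs gs t).flatMap (Gate.relabel lab) = mcxLadder cs gs t := by
  fun_induction mcxLadder (ι := ℕ) cs gs t <;> simp_all [mcxLadder, Gate.relabel]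

theorem mcx_flatMap_relabel (lab : ℕ → List ι) (cs gs : List W) (t : W) :
    (mcx cs gs t).flatMap (Gate.relabel lab) = mcx cs gs t := by
  unfold mcx
  split <;> simp [mcxLadder_flatMap_relabel]

theorem map_x_flatMap_relabel (lab : ℕ → List ι) (L : List W) :
    (L.map Gate.x).flatMap (Gate.relabel lab) = L.map Gate.x := by
  induction L with
  | nil => rfl
  | cons i L ih => simp [Gate.relabel, ih]

theorem balancedVisit_eq_flatMap (lab : ℕ → List ι) (c b : W) (vars anc : List W) (p : ℕ) :
    balancedVisit lab c b vars anc p =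
      (balancedVisit (fun i => [i]) c b vars anc p).flatMap (Gate.relabel lab) := by
  fun_induction balancedVisit lab c b vars anc p <;>
    simp_all [balancedVisit, Gate.relabel, load_flatMap_relabel]

theorem skewNode_eq_flatMap (lab : ℕ → List ι) (z f c : W) (q : ℕ) :
    skewNode lab z f c q = (skewNode (fun i => [i]) z f c q).flatMap (Gate.relabel lab) := by
  simp [skewNode, Gate.relabel, load_flatMap_relabel, ← skewLabels_eq_flatMap]

theorem skewVisit_eq_flatMap (lab : ℕ → List ι) (z f c b : W) (vars anc : List W) (p : ℕ) :
    skewVisit lab z f c b vars anc p =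
      (skewVisit (fun i => [i]) z f c b vars anc p).flatMap (Gate.relabel lab) := by
  fun_induction skewVisit lab z f c b vars anc p <;>
    simp_all [skewVisit, Gate.relabel, ← skewNode_eq_flatMap]

/-- The labels do not influence the wiring. Hence all reads of one shape can be compared through the
singleton-label read, with the weight transported along `lab`. -/
theorem treeRead_eq_flatMap (τ : TreeShape) (lab : ℕ → List ι) (c : W) (sel anc : List W) :
    treeRead τ lab c sel anc =
      (treeRead τ (fun i => [i]) c sel anc).flatMap (Gate.relabel lab) := by
  cases τ with
  | balanced =>
    simp only [treeRead, balancedRead]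
    split <;> simp_all [Gate.relabel, load_flatMap_relabel, ← balancedVisit_eq_flatMap]
  | skew =>
    simp only [treeRead, skewRead]
    split
    · simp [load_flatMap_relabel, ← skewLabels_eq_flatMap]
    · rfl
    · split <;> simp [Gate.relabel, ← skewVisit_eq_flatMap, ← skewNode_eq_flatMap,
        map_x_flatMap_relabel, mcx_flatMap_relabel]

theorem exists_op_of_mem_flatMap_relabel (lab : ℕ → List ι) (C : Circuit W ℕ) (c : W) (l : ι)
    (h : Gate.op c l ∈ C.flatMap (Gate.relabel lab)) : ∃ i, Gate.op c i ∈ C ∧ l ∈ lab i := by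
  rw [List.mem_flatMap] at h
  obtain ⟨g, hg, h⟩ := h
  cases g with
  | op d i =>
    simp only [Gate.relabel, load, List.mem_map, Gate.op.injEq] at h
    obtain ⟨a, ha, rfl, rfl⟩ := h
    exact ⟨i, hg, ha⟩
  | _ => simp [Gate.relabel] at h

end Relabel

/-! ### The multiply controlled NOT with borrowed wires. -/

section Mcx

variable {W ι : Type}

namespace Circuit

theorem wellFormed_mcxLadder (cs gs : List W) (t : W) (h : (t :: (cs ++ gs)).Nodup) :
    WellFormed (mcxLadder cs gs t : Circuit W ι) := by
  fun_induction mcxLadder (ι := ι) cs gs t with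
  | case4 c cs g gs t _ _ ih =>
    simp only [List.cons_append, List.nodup_cons, List.nodup_append, List.mem_cons,
        List.mem_append, not_or] at h ih
    simp only [wellFormed_append, wellFormed_cons, wellFormed_nil, Gate.WellFormed]
    grind
  | _ =>
    simp_all only [wellFormed_cons, wellFormed_nil, Gate.WellFormed, List.nodup_cons,
      List.cons_append, List.mem_cons, not_or, and_true, ne_eq, List.nil_append]
    try grind

theorem wellFormed_mcx (cs gs : List W) (t : W) (h : (t :: (cs ++ gs)).Nodup) :
    WellFormed (mcx cs gs t : Circuit W ι) := by
  unfold mcx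
  split
  · refine (wellFormed_append _ _).2 ⟨wellFormed_mcxLadder _ _ _ h, wellFormed_mcxLadder _ _ _ ?_⟩
    simp only [List.cons_append, List.nodup_cons, List.nodup_append, List.mem_cons,
        List.mem_append, not_or] at h ⊢
    grind
  · exact wellFormed_mcxLadder _ _ _ h

theorem toffoliCount_mcxLadder (cs gs : List W) (t : W) (h2 : 2 ≤ cs.length)
    (hl : cs.length ≤ gs.length + 2) :
    toffoliCount (mcxLadder cs gs t : Circuit W ι) = 2 * cs.length - 3 := by
  fun_induction mcxLadder (ι := ι) cs gs t with
  | case4 c cs g gs t _ h ih =>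
    have : 2 ≤ cs.length := by
      match cs with
      | [] => simp_all
      | [_] => simp_all
      | _ :: _ :: _ => simp
    simp only [List.length_cons] at hl
    simp [ih this (by omega), Gate.isToffoli]
    omega
  | case5 cs t h0 h1 h2 =>
    exfalso
    match cs with
    | [] | [_] | [_, _] | _ :: _ :: _ :: _ => simp_all
  | _ => simp_all [Gate.isToffoli]

/-- The Toffoli cost of a multiply controlled NOT with `k` controls. -/
def mcxCost : ℕ → ℕ
  | 0 | 1 => 0
  | 2 => 1
  | k => 4 * k - 8

theorem mcxCost_le (k : ℕ) : mcxCost k ≤ 4 * k := by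
  unfold mcxCost
  split <;> omega

theorem toffoliCount_mcx (cs gs : List W) (t : W) (hl : cs.length ≤ gs.length + 2) :
    toffoliCount (mcx cs gs t : Circuit W ι) = mcxCost cs.length := by
  match cs, gs with
  | [], gs => simp [mcx, mcxLadder, mcxCost, Gate.isToffoli]
  | [c], gs => simp [mcx, mcxLadder, mcxCost, Gate.isToffoli]
  | [c₁, c₂], gs => simp [mcx, mcxLadder, mcxCost, Gate.isToffoli]
  | c₁ :: c₂ :: c₃ :: cs, [] => simp at hl
  | c₁ :: c₂ :: c₃ :: cs, g :: gs =>
    simp only [List.length_cons] at hl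
    rw [mcx, toffoliCount_append, toffoliCount_mcxLadder _ _ _ (by simp) (by simpa using hl),
      toffoliCount_mcxLadder _ _ _ (by simp) (by simpa using hl)]
    simp only [List.length_cons, mcxCost]
    omega

theorem op_notMem_mcxLadder (cs gs : List W) (t c : W) (i : ι) :
    Gate.op c i ∉ mcxLadder cs gs t := by
  fun_induction mcxLadder (ι := ι) cs gs t <;> simp_all

theorem op_notMem_mcx (cs gs : List W) (t c : W) (i : ι) : Gate.op c i ∉ mcx cs gs t := by
  unfold mcx
  split <;> simp [op_notMem_mcxLadder]

end Circuit

variable [DecidableEq W]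

namespace Circuit

theorem pull_mcxLadder_of_notMem (cs gs : List W) (t w : W) (hw : w ∉ t :: gs) (s : W → Bool) :
    pull (mcxLadder cs gs t : Circuit W ι) s w = s w := by
  fun_induction mcxLadder (ι := ι) cs gs t generalizing s <;>
    simp_all [Gate.pull, Function.update_of_ne]

/-- A ladder neither reads nor writes a foreign wire. In `pull_mcx` that wire is the target, and the
ladder is the one that cleans up the borrowed wires. -/
theorem pull_mcxLadder_update (cs gs : List W) (t r : W) (v : Bool) (s : W → Bool)
    (hr : r ∉ t :: (cs ++ gs)) :
    pull (mcxLadder cs gs t : Circuit W ι) (Function.update s r v) =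
      Function.update (pull (mcxLadder cs gs t : Circuit W ι) s) r v := by
  fun_induction mcxLadder (ι := ι) cs gs t generalizing s with
  | case1 =>
    simp_all [Gate.pull, Function.update_of_ne, Function.update_comm, Ne.symm]
  | case2 =>
    simp_all [Gate.pull, Function.update_of_ne, Function.update_comm, Ne.symm]
  | case3 =>
    simp_all [Gate.pull, Function.update_of_ne, Function.update_comm, Ne.symm]
  | case4 c cs g gs t _ _ ih =>
    simp only [List.cons_append, List.mem_cons, List.mem_append, not_or] at hr ih
    simp only [pull_append, pull_cons, pull_nil, Gate.pull,
      Function.update_of_ne (Ne.symm hr.1), Function.update_of_ne (Ne.symm hr.2.1),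
      Function.update_of_ne (Ne.symm hr.2.2.2.1), Function.update_comm hr.1,
      ih _ ⟨hr.2.2.2.1, hr.2.2.1, hr.2.2.2.2⟩]
  | case5 => simp

theorem pull_toffoli_toffoli (a b t : W) (ha : a ≠ t) (hb : b ≠ t) (s : W → Bool) :
    (Gate.toffoli a b t : Gate W ι).pull ((Gate.toffoli a b t : Gate W ι).pull s) = s := by
  simp [Gate.pull, Function.update_of_ne, ha, hb]

/-- The ladder is a palindrome of involutions. -/
theorem pull_mcxLadder_pull (cs gs : List W) (t : W) (h : (t :: (cs ++ gs)).Nodup)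
    (s : W → Bool) :
    pull (mcxLadder cs gs t : Circuit W ι) (pull (mcxLadder cs gs t : Circuit W ι) s) = s := by
  fun_induction mcxLadder (ι := ι) cs gs t generalizing s with
  | case1 => simp [Gate.pull]
  | case2 => simp_all [Gate.pull, Function.update_of_ne, Ne.symm]
  | case3 => simp_all [Gate.pull, Function.update_of_ne, Ne.symm]
  | case4 c cs g gs t _ _ ih =>
    have h1 : c ≠ t := by rintro rfl; simp at h
    have h2 : g ≠ t := by rintro rfl; simp at h
    have h3 : (g :: (cs ++ gs)).Nodup := by
      simp only [List.cons_append, List.nodup_cons, List.nodup_append, List.mem_cons,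
        List.mem_append] at h ⊢
      grind
    simp only [pull_append, pull_cons, pull_nil, pull_toffoli_toffoli c g t h1 h2, ih h3]
  | case5 => simp

theorem pull_mcxLadder_target (cs gs : List W) (t : W) (h : (t :: (cs ++ gs)).Nodup)
    (hl : cs.length ≤ gs.length + 2) (s : W → Bool) :
    pull (mcxLadder cs gs t : Circuit W ι) s t = xor (s t) (cs.all s) := by
  fun_induction mcxLadder (ι := ι) cs gs t generalizing s with
  | case1 => simp [Gate.pull]
  | case2 => simp_all [Gate.pull]
  | case3 => simp_all [Gate.pull]
  | case4 c cs g gs t _ _ ih =>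
    simp only [List.cons_append, List.nodup_cons, List.nodup_append, List.mem_cons,
        List.mem_append, not_or] at h
    have h1 : c ≠ t := by grind
    have h2 : g ≠ t := by grind
    have h3 : (g :: (cs ++ gs)).Nodup := by
      simp only [List.nodup_cons, List.nodup_append, List.mem_append]
      grind
    have h4 : c ∉ g :: gs := by simp only [List.mem_cons]; grind
    have h5 : t ∉ g :: gs := by simp only [List.mem_cons]; grind
    have h6 : ∀ v, cs.all (Function.update s t v) = cs.all s := fun v => by
      rw [Bool.eq_iff_iff, List.all_eq_true, List.all_eq_true]
      refine forall₂_congr fun x hx => ?_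
      rw [Function.update_of_ne]
      grind
    simp only [List.length_cons] at hl
    simp only [pull_append, pull_cons, pull_nil, Gate.pull, Function.update_self,
      pull_mcxLadder_of_notMem cs gs g _ h4, pull_mcxLadder_of_notMem cs gs g _ h5,
      ih h3 (by omega), h6, Function.update_of_ne h1, Function.update_of_ne h2, List.all_cons]
    -- Over 𝔽₂ this is `c g + c (g + ∏ cs) = c ∏ cs`: the unknown value of the borrowed wire `g`
    -- drops out.
    generalize s t = a, s c = b, s g = d, cs.all s = e
    revert a b d e
    decide
  -- Three or more controls with no borrowed wire: the default empty circuit, excluded by the length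
  -- bound.
  | case5 cs t h0 h1 h2 =>
    exfalso
    match cs with
    | [] | [_] | [_, _] | _ :: _ :: _ :: _ => simp_all

/-- The multiply controlled NOT flips its target if all the controls are on, and restores the
borrowed wires. -/
theorem pull_mcx (cs gs : List W) (t : W) (h : (t :: (cs ++ gs)).Nodup)
    (hl : cs.length ≤ gs.length + 2) (s : W → Bool) :
    pull (mcx cs gs t : Circuit W ι) s = Function.update s t (xor (s t) (cs.all s)) := by
  have small : ∀ cs gs : List W, (t :: (cs ++ gs)).Nodup → cs.length ≤ gs.length + 2 →
      (cs.length ≤ 2) →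
      pull (mcxLadder cs gs t : Circuit W ι) s = Function.update s t (xor (s t) (cs.all s)) := by
    intro cs gs h hl hcs
    match cs, hcs with
    | [], _ => simp [mcxLadder, Gate.pull]
    | [c], _ => simp [mcxLadder, Gate.pull]
    | [c₁, c₂], _ => simp [mcxLadder, Gate.pull]
  match cs, gs with
  | [], gs => exact small _ _ h hl (by simp)
  | [c], gs => exact small _ _ h hl (by simp)
  | [c₁, c₂], gs => exact small _ _ h hl (by simp)
  | c₁ :: c₂ :: c₃ :: cs, [] => simp at hl
  | c₁ :: c₂ :: c₃ :: cs, g :: gs =>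
    simp only [mcx]
    rw [mcxLadder]
    · generalize hds : c₂ :: c₃ :: cs = ds at *
      simp only [List.cons_append, List.nodup_cons, List.nodup_append, List.mem_cons,
        List.mem_append, not_or] at h
      have h1 : c₁ ≠ t := by grind
      have h2 : g ≠ t := by grind
      have h3 : (g :: (ds ++ gs)).Nodup := by
        simp only [List.nodup_cons, List.nodup_append, List.mem_append]
        grind
      have h4 : c₁ ∉ g :: gs := by simp only [List.mem_cons]; grind
      have h5 : t ∉ g :: (ds ++ gs) := by simp only [List.mem_cons, List.mem_append]; grind
      have h6 : t ∉ g :: gs := by simp only [List.mem_cons]; grind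
      simp only [List.length_cons] at hl
      -- The trailing ladder onto `g` equals the one inside the big ladder. It commutes past updates
      -- of `t`, so the two cancel on the borrowed wires.
      simp only [pull_append, pull_cons, pull_nil, Gate.pull, pull_mcxLadder_update _ _ _ _ _ _ h5,
        pull_mcxLadder_pull ds gs g h3, pull_mcxLadder_of_notMem ds gs g _ h4,
        pull_mcxLadder_of_notMem ds gs g _ h6,
        pull_mcxLadder_target ds gs g h3 (by omega), Function.update_self, Function.update_idem,
        Function.update_of_ne h1, Function.update_of_ne h2, List.all_cons]
      congr 1
      generalize s t = a, s c₁ = b, s g = d, ds.all s = e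
      revert a b d e
      decide
    · simp
    · simp

@[simp] theorem emit_mcxLadder (w : ι → Bool) (cs gs : List W) (t : W) (s : W → Bool) :
    emit w (mcxLadder cs gs t) s = false := by
  fun_induction mcxLadder (ι := ι) cs gs t generalizing s <;> simp_all

@[simp] theorem emit_mcx (w : ι → Bool) (cs gs : List W) (t : W) (s : W → Bool) :
    emit w (mcx cs gs t) s = false := by
  unfold mcx
  split <;> simp

theorem pull_map_x (L : List W) (hL : L.Nodup) (s : W → Bool) (w : W) :
    pull (L.map Gate.x : Circuit W ι) s w = xor (s w) (decide (w ∈ L)) := by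
  induction L with
  | nil => simp
  | cons a L ih =>
    simp only [List.nodup_cons] at hL
    rw [List.map_cons, pull_cons, Gate.pull]
    by_cases h : w = a
    · subst h
      simp [ih hL.2, hL.1]
    · simp [ih hL.2, h]

theorem emit_map_x (w : ι → Bool) (L : List W) (s : W → Bool) :
    emit w (L.map Gate.x) s = false := by
  induction L with
  | nil => rfl
  | cons a L ih => simpa using ih

end Circuit

end Mcx

/-! ### Binary digits. -/

/-- The number with the given binary digits, most significant first, below the digits of `p`. -/
def bitsVal : ℕ → List Bool → ℕ
  | p, [] => p
  | p, b :: L => bitsVal (2 * p + b.toNat) L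

/-- The number with the given binary digits, least significant first. -/
def lsbVal : List Bool → ℕ
  | [] => 0
  | b :: L => b.toNat + 2 * lsbVal L

theorem bitsVal_append_singleton (p : ℕ) (L : List Bool) (b : Bool) :
    bitsVal p (L ++ [b]) = 2 * bitsVal p L + b.toNat := by
  induction L generalizing p with
  | nil => rfl
  | cons a L ih => exact ih _

theorem bitsVal_zero_reverse (L : List Bool) : bitsVal 0 L.reverse = lsbVal L := by
  induction L with
  | nil => rfl
  | cons b L ih => rw [List.reverse_cons, bitsVal_append_singleton, ih, lsbVal, add_comm]

theorem lsbVal_append (L M : List Bool) :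
    lsbVal (L ++ M) = lsbVal L + 2 ^ L.length * lsbVal M := by
  induction L with
  | nil => simp [lsbVal]
  | cons b L ih => simp only [List.cons_append, lsbVal, ih, List.length_cons, pow_succ]; ring

theorem lsbVal_lt (L : List Bool) : lsbVal L < 2 ^ L.length := by
  induction L with
  | nil => simp [lsbVal]
  | cons b L ih =>
    have := b.toNat_lt
    simp only [lsbVal, List.length_cons, pow_succ]
    omega

theorem testBit_lsbVal (L : List Bool) (i : ℕ) (hi : i < L.length) :
    (lsbVal L).testBit i = L[i] := by
  induction L generalizing i with
  | nil => simp at hi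
  | cons b L ih =>
    cases i with
    | zero => cases b <;> simp [lsbVal, Nat.testBit_zero, Nat.add_mod]
    | succ i =>
      rw [Nat.testBit_succ, lsbVal]
      have : (b.toNat + 2 * lsbVal L) / 2 = lsbVal L := by
        have := b.toNat_lt
        omega
      rw [this]
      exact ih i (by simpa using hi)

theorem map_eq_map_of_forall_mem {W : Type} {s s' : W → Bool} {L : List W}
    (h : ∀ v ∈ L, s v = s' v) : L.map s = L.map s' := List.map_congr_left h

/-! ### Toggling the root on a given value of the top register. -/

section Toggle

variable {W ι : Type} [DecidableEq W]

namespace Circuit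

/-- Conjugation by NOTs makes the controls in `F` negative. It serves both the root toggle and the
clean-up of a skew read. -/
theorem pull_conj_mcx (F cs gs : List W) (t : W) (hF : F.Nodup) (htF : t ∉ F)
    (h : (t :: (cs ++ gs)).Nodup) (hl : cs.length ≤ gs.length + 2) (s : W → Bool) :
    pull ((F.map Gate.x ++ mcx cs gs t ++ F.map Gate.x : Circuit W ι)) s =
      Function.update s t (xor (s t) (cs.all fun c => xor (s c) (decide (c ∈ F)))) := by
  simp only [pull_append, pull_mcx cs gs t h hl]
  funext v
  rw [pull_map_x _ hF]
  by_cases hv : v = t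
  · subst hv
    have : pull (F.map Gate.x : Circuit W ι) s = fun c => xor (s c) (decide (c ∈ F)) :=
      funext (pull_map_x F hF s)
    simp [this, htF]
  · simp [Function.update_of_ne hv, pull_map_x _ hF]

theorem pull_toggleOn (top gs : List W) (root : W) (j : ℕ) (h : (root :: (top ++ gs)).Nodup)
    (hl : top.length ≤ gs.length + 2) (hj : j < 2 ^ top.length) (s : W → Bool) :
    pull (toggleOn top gs root j : Circuit W ι) s =
      Function.update s root (xor (s root) (decide (lsbVal (top.map s) = j))) := by
  have htop : top.Nodup := (List.nodup_append.1 (List.nodup_cons.1 h).2).1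
  set F := ((top.zipIdx.filter (fun q => !(j.testBit q.2))).map (fun q => q.1)) with hFdef
  have hsub : F.Sublist top := by
    have := (List.filter_sublist (p := fun q : W × ℕ => !(j.testBit q.2))
      (l := top.zipIdx)).map (fun q => q.1)
    rwa [show (fun q : W × ℕ => q.1) = Prod.fst from rfl, List.zipIdx_map_fst] at this
  -- The negated wires are those where `j` has digit `0`, so the controls fire exactly when every
  -- digit agrees with `j`.
  have hmem : ∀ i (hi : i < top.length), top[i] ∈ F ↔ j.testBit i = false := by
    intro i hi
    simp only [hFdef, List.mem_map, List.mem_filter, Prod.exists, exists_and_right, exists_eq_right,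
      Bool.not_eq_true']
    constructor
    · rintro ⟨k, hk, hjk⟩
      rw [List.mem_zipIdx_iff_getElem?] at hk
      obtain ⟨hk', hk⟩ := List.getElem?_eq_some_iff.1 hk
      have := (htop.getElem_inj_iff).1 hk
      simp only at this
      rwa [← this]
    · intro hji
      exact ⟨i, List.mem_zipIdx_iff_getElem?.2 (List.getElem?_eq_getElem hi), hji⟩
  have : (toggleOn top gs root j : Circuit W ι) = F.map Gate.x ++ mcx top gs root ++ F.map Gate.x := by
    simp [toggleOn, hFdef, List.map_map, Function.comp_def]
  rw [this, pull_conj_mcx F top gs root (htop.sublist hsub)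
    (fun hr => (List.nodup_cons.1 h).1 (List.mem_append_left _ (hsub.subset hr))) h hl]
  congr 2
  rw [Bool.eq_iff_iff, List.all_eq_true, decide_eq_true_iff]
  constructor
  · intro hall
    refine Nat.eq_of_testBit_eq fun i => ?_
    by_cases hi : i < top.length
    · have h1 := hall _ (List.getElem_mem hi)
      rw [testBit_lsbVal _ i (by simpa using hi), List.getElem_map]
      have h2 := hmem i hi
      by_cases hb : top[i] ∈ F
      · simp_all
      · simp_all
    -- Beyond the register both numbers have only zero digits; for `j` this is the bound `hj`.
    · have h2 : 2 ^ top.length ≤ 2 ^ i := Nat.pow_le_pow_right (by simp) (not_lt.1 hi)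
      have h3 := lsbVal_lt (top.map s)
      rw [List.length_map] at h3
      rw [Nat.testBit_lt_two_pow (h3.trans_le h2), Nat.testBit_lt_two_pow (hj.trans_le h2)]
  · intro heq c hc
    obtain ⟨i, hi, rfl⟩ := List.getElem_of_mem hc
    have h1 := testBit_lsbVal (top.map s) i (by simpa using hi)
    rw [heq, List.getElem_map] at h1
    have h2 := hmem i hi
    rw [h1] at h2
    by_cases hb : s top[i] = true
    · simp_all
    · simp_all

theorem emit_toggleOn (w : ι → Bool) (top gs : List W) (root : W) (j : ℕ) (s : W → Bool) :
    emit w (toggleOn top gs root j) s = false := by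
  have : ∀ (L : List (W × ℕ)) s, emit w (L.map fun q => Gate.x q.1) s = false := by
    intro L
    induction L with
    | nil => simp
    | cons a L ih => simpa using ih
  simp [toggleOn, this]

end Circuit

end Toggle

section

variable {W ι : Type}

namespace Circuit

theorem wellFormed_toggleOn (top gs : List W) (root : W) (j : ℕ) (h : (root :: (top ++ gs)).Nodup) :
    WellFormed (toggleOn top gs root j : Circuit W ι) := by
  simp [toggleOn, wellFormed_mcx _ _ _ h]

theorem toffoliCount_toggleOn (top gs : List W) (root : W) (j : ℕ)
    (hl : top.length ≤ gs.length + 2) :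
    toffoliCount (toggleOn top gs root j : Circuit W ι) = mcxCost top.length := by
  simp [toggleOn, toffoliCount_mcx _ _ _ hl]

theorem op_notMem_toggleOn (top gs : List W) (root : W) (j : ℕ) (c : W) (i : ι) :
    Gate.op c i ∉ toggleOn top gs root j := by
  simp [toggleOn, op_notMem_mcx]

end Circuit

end

theorem xor_xor_xor_comm (a b c d : Bool) :
    xor (xor a b) (xor c d) = xor (xor a c) (xor b d) := by
  revert a b c d
  decide

/-! ### Traversal of the balanced tree with dirty ancillae. -/

section BalancedTree

variable {W ι : Type} [DecidableEq W]

namespace Circuit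

theorem pull_balancedVisit (lab : ℕ → List ι) (c b : W) (vars anc : List W) (p : ℕ)
    (h : (c :: b :: (vars ++ anc)).Nodup) (hl : vars.length ≤ anc.length) (s : W → Bool) :
    pull (balancedVisit lab c b vars anc p) s = s := by
  induction vars generalizing c b anc p s with
  | nil =>
    have : c ≠ b := by rintro rfl; simp at h
    simp [balancedVisit, Gate.pull, Function.update_of_ne this]
  | cons z vars ih =>
    match anc, hl with
    | e :: anc, hl =>
      simp only [List.cons_append, List.nodup_cons, List.nodup_append, List.mem_cons,
        List.mem_append, not_or, List.length_cons] at h hl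
      have hcb : c ≠ b := h.1.1
      have hce : c ≠ e := h.1.2.2.2.1
      have hze : z ≠ e := h.2.2.1.2.1
      have hbe : b ≠ e := h.2.1.2.2.1
      have hzb : z ≠ b := Ne.symm h.2.1.1
      have h' : (b :: e :: (vars ++ anc)).Nodup := by
        simp only [List.nodup_cons, List.nodup_append, List.mem_cons, List.mem_append]
        grind
      simp only [balancedVisit, pull_append, pull_cons, pull_nil, ih _ _ _ _ h' (by omega),
        Gate.pull]
      funext v
      by_cases hv : v = e
      · subst hv
        simp only [ne_eq, hcb, hce, hze, hbe, hzb, Ne.symm hbe, not_false_eq_true,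
          Function.update_of_ne, Function.update_self]
        generalize s b = x1, s c = x2, s v = x3, s z = x4
        revert x1 x2 x3 x4
        decide
      · by_cases hv' : v = b
        · subst hv'
          simp [hcb, hce, hze, hbe, hzb, Ne.symm hbe]
        · simp [hv, hv']

/-- The two runs may differ on the edge wires `c` and `b` only. With `Δ` for the difference of the
runs, the left child is entered with `Δc + Δb` and the right child with `Δb`. The next edge wire `e`
starts from the same unknown value in both runs, so its difference is the parent's difference times
the selection bit, and the induction closes. -/
theorem emit_balancedVisit_xor (w : ℕ → Bool) (c b : W) (vars anc : List W) (p : ℕ)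
    (h : (c :: b :: (vars ++ anc)).Nodup) (hl : vars.length ≤ anc.length) (s s' : W → Bool)
    (hs : ∀ v ∈ vars ++ anc, s v = s' v) :
    xor (emit w (balancedVisit (fun i => [i]) c b vars anc p) s)
        (emit w (balancedVisit (fun i => [i]) c b vars anc p) s') =
      xor (xor (xor (s c) (s' c)) (xor (s b) (s' b)) && w (bitsVal (2 * p) (vars.map s)))
        (xor (s b) (s' b) && w (bitsVal (2 * p + 1) (vars.map s))) := by
  induction vars generalizing c b anc p s s' with
  | nil =>
    simp [balancedVisit, Gate.pull, bitsVal]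
    generalize s c = x1, s b = x2, s' c = x3, s' b = x4, w (2 * p) = x5, w (2 * p + 1) = x6
    revert x1 x2 x3 x4 x5 x6
    decide
  | cons z vars ih =>
    match anc, hl with
    | e :: anc, hl =>
      simp only [List.cons_append, List.nodup_cons, List.nodup_append, List.mem_cons,
        List.mem_append, not_or, List.length_cons] at h hl
      have hcb : c ≠ b := h.1.1
      have hce : c ≠ e := h.1.2.2.2.1
      have hze : z ≠ e := h.2.2.1.2.1
      have hbe : b ≠ e := h.2.1.2.2.1
      have hzb : z ≠ b := Ne.symm h.2.1.1
      have h' : (b :: e :: (vars ++ anc)).Nodup := by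
        simp only [List.nodup_cons, List.nodup_append, List.mem_cons, List.mem_append]
        grind
      have hb : ∀ v ∈ vars ++ anc, v ≠ b := by
        simp only [List.mem_append]; grind
      have he : ∀ v ∈ vars ++ anc, v ≠ e := by
        simp only [List.mem_append]; grind
      have hsz : s' z = s z := (hs z (by simp)).symm
      have hse : s' e = s e := (hs e (by simp)).symm
      have hs' : ∀ v ∈ vars ++ anc, s v = s' v := fun v hv => hs v (by
        simp only [List.mem_append, List.mem_cons] at hv ⊢; grind)
      -- Going backwards, `T₁ r` is the state just after the right subtree and `T₂ r` the one just
      -- after the left subtree; the right subtree itself leaves no trace.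
      let T₁ : (W → Bool) → W → Bool := fun r => Function.update r e (xor (r e) (r b && r z))
      let T₂ : (W → Bool) → W → Bool := fun r =>
        (Gate.toffoli c z e : Gate W ℕ).pull ((Gate.cnot c b : Gate W ℕ).pull (T₁ r))
      have hT₁b : ∀ r, T₁ r b = r b := fun r => by simp [T₁, hbe]
      have hT₁e : ∀ r, T₁ r e = xor (r e) (r b && r z) := fun r => by simp [T₁]
      have hT₁o : ∀ r, ∀ v ∈ vars ++ anc, T₁ r v = r v := fun r v hv => by simp [T₁, he v hv]
      have hT₂b : ∀ r, T₂ r b = xor (r b) (r c) := fun r => by simp [T₁, T₂, Gate.pull, hbe, hce]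
      have hT₂e : ∀ r, T₂ r e = xor (xor (r e) (r b && r z)) (r c && r z) := fun r => by
        simp [T₁, T₂, Gate.pull, hcb, hce, hze, hzb, Ne.symm hbe]
      have hT₂o : ∀ r, ∀ v ∈ vars ++ anc, T₂ r v = r v := fun r v hv => by
        simp [T₁, T₂, Gate.pull, he v hv, hb v hv]
      have hemit : ∀ r, emit w (balancedVisit (fun i => [i]) c b (z :: vars) (e :: anc) p) r =
          xor (emit w (balancedVisit (fun i => [i]) b e vars anc (2 * p + 1)) (T₁ r))
            (emit w (balancedVisit (fun i => [i]) b e vars anc (2 * p)) (T₂ r)) := fun r => by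
        simp only [balancedVisit, emit_append, pull_cons, pull_nil, emit_cons_cnot,
          emit_cons_toffoli, emit_nil, pull_balancedVisit _ _ _ _ _ _ h' (show _ ≤ _ by omega),
          Bool.false_xor, Bool.xor_false]
        rfl
      have h₁ := ih b e anc (2 * p + 1) h' (by omega) (T₁ s) (T₁ s')
        (fun v hv => by rw [hT₁o _ v hv, hT₁o _ v hv, hs' v hv])
      have h₂ := ih b e anc (2 * p) h' (by omega) (T₂ s) (T₂ s')
        (fun v hv => by rw [hT₂o _ v hv, hT₂o _ v hv, hs' v hv])
      rw [map_eq_map_of_forall_mem (fun v hv => hT₁o s v (List.mem_append_left _ hv)), hT₁b, hT₁b,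
        hT₁e, hT₁e, hsz, hse] at h₁
      rw [map_eq_map_of_forall_mem (fun v hv => hT₂o s v (List.mem_append_left _ hv)), hT₂b, hT₂b,
        hT₂e, hT₂e, hsz, hse] at h₂
      rw [hemit, hemit, xor_xor_xor_comm, h₁, h₂, List.map_cons, bitsVal, bitsVal]
      generalize s e = x1, s b = x2, s c = x3, s' b = x4, s' c = x5
      cases s z <;>
      · simp only [Bool.toNat_false, Bool.toNat_true, add_zero]
        generalize w (bitsVal _ _) = y1, w (bitsVal _ _) = y2, w (bitsVal _ _) = y3,
          w (bitsVal _ _) = y4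
        revert x1 x2 x3 x4 x5 y1 y2 y3 y4
        decide

end Circuit
end BalancedTree

/-! ### The balanced read: operands, cost, labels, and the difference property. -/

section BalancedRead

variable {W ι : Type}

namespace Circuit

theorem wellFormed_balancedVisit (lab : ℕ → List ι) (c b : W) (vars anc : List W) (p : ℕ)
    (h : (c :: b :: (vars ++ anc)).Nodup) : WellFormed (balancedVisit lab c b vars anc p) := by
  fun_induction balancedVisit lab c b vars anc p with
  | case1 => simp_all [Gate.WellFormed]
  | case2 c b p z vars e anc ih₂ ih₁ =>
    simp only [List.cons_append, List.nodup_cons, List.nodup_append, List.mem_cons,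
      List.mem_append, not_or] at h ih₁ ih₂
    simp only [wellFormed_append, wellFormed_cons, wellFormed_nil, Gate.WellFormed]
    grind
  | case3 => simp

/-- Solution of `V(l+1) = 2 V(l) + 3`, `V(0) = 0`; adding `3` makes it geometric and avoids
truncated subtraction. -/
theorem toffoliCount_balancedVisit (lab : ℕ → List ι) (c b : W) (vars anc : List W) (p : ℕ)
    (hl : vars.length ≤ anc.length) :
    toffoliCount (balancedVisit lab c b vars anc p) + 3 = 3 * 2 ^ vars.length := by
  fun_induction balancedVisit lab c b vars anc p with
  | case1 => simp [Gate.isToffoli]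
  | case2 c b p z vars e anc ih₂ ih₁ =>
    simp only [List.length_cons, add_le_add_iff_right] at hl
    specialize ih₁ hl
    specialize ih₂ hl
    simp [Gate.isToffoli, pow_succ]
    omega
  | case3 => simp at hl

/-- The `U i` are assumed to be commuting involutions only for indices in range, so the labels of
the garbage operations have to stay in range too. -/
theorem lt_of_op_mem_balancedVisit (c b : W) (vars anc : List W) (p : ℕ) (d : W) (i : ℕ)
    (h : Gate.op d i ∈ balancedVisit (fun i => [i]) c b vars anc p) :
    i < 2 ^ (vars.length + 1) * (p + 1) := by
  induction vars generalizing c b anc p with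
  | nil =>
    simp [balancedVisit, load] at h
    simp
    omega
  | cons z vars ih =>
    match anc with
    | [] => simp [balancedVisit] at h
    | e :: anc =>
      simp [balancedVisit] at h
      rw [List.length_cons, pow_succ, mul_assoc]
      rcases h with h | h
      · exact (ih _ _ _ _ h).trans_le (Nat.mul_le_mul_left _ (by omega))
      · exact (ih _ _ _ _ h).trans_le (Nat.mul_le_mul_left _ (by omega))

/-- The Toffoli cost of a read over `2 ^ m` indices. -/
def treeCost : TreeShape → ℕ → ℕ
  | .balanced, 0 => 0
  | .balanced, m + 1 => 3 * 2 ^ m - 1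
  | .skew, 0 => 0
  | .skew, 1 => 2
  | .skew, m + 2 => 5 * 2 ^ m - 1 + mcxCost (m + 2)

theorem wellFormed_balancedRead (lab : ℕ → List ι) (c : W) (sel anc : List W)
    (h : (c :: (sel ++ anc)).Nodup) : WellFormed (balancedRead lab c sel anc) := by
  unfold balancedRead
  split
  · simp
  · rename_i y vars b anc hsel
    obtain rfl : sel = vars.reverse ++ [y] := by
      rw [← List.reverse_reverse sel, hsel, List.reverse_cons]
    have h' : (c :: b :: (vars ++ anc)).Nodup := by
      simp only [List.nodup_cons, List.nodup_append, List.mem_cons, List.mem_append, not_or,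
        List.mem_reverse, List.nodup_reverse] at h ⊢
      grind
    simp only [List.nodup_cons, List.nodup_append, List.mem_cons, List.mem_append, not_or,
        List.mem_reverse] at h
    simp only [wellFormed_append, wellFormed_cons, wellFormed_nil, Gate.WellFormed,
      wellFormed_balancedVisit lab c b vars anc 0 h']
    grind
  · simp

theorem toffoliCount_balancedRead (lab : ℕ → List ι) (c : W) (sel anc : List W)
    (hl : sel.length ≤ anc.length) :
    toffoliCount (balancedRead lab c sel anc) = treeCost .balanced sel.length := by
  unfold balancedRead
  split
  · simp_all [treeCost]
  · rename_i y vars b anc hsel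
    have hlen : sel.length = vars.length + 1 := by
      rw [← List.length_reverse, hsel, List.length_cons]
    rw [hlen, List.length_cons] at hl
    have := toffoliCount_balancedVisit lab c b vars anc 0 (by omega)
    rw [hlen, treeCost]
    simp [Gate.isToffoli]
    omega
  · simp_all

theorem lt_of_op_mem_balancedRead (c : W) (sel anc : List W) (d : W) (i : ℕ)
    (h : Gate.op d i ∈ balancedRead (fun i => [i]) c sel anc) : i < 2 ^ sel.length := by
  unfold balancedRead at h
  split at h
  · simp_all [load]
  · rename_i y vars b anc hsel
    have hlen : sel.length = vars.length + 1 := by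
      rw [← List.length_reverse, hsel, List.length_cons]
    simp at h
    simpa [hlen] using lt_of_op_mem_balancedVisit _ _ _ _ _ _ _ h
  · simp at h

variable [DecidableEq W]

theorem pull_balancedRead (lab : ℕ → List ι) (c : W) (sel anc : List W)
    (h : (c :: (sel ++ anc)).Nodup) (hl : sel.length ≤ anc.length) (s : W → Bool) :
    pull (balancedRead lab c sel anc) s = s := by
  unfold balancedRead
  split
  · simp
  · rename_i y vars b anc hsel
    obtain rfl : sel = vars.reverse ++ [y] := by
      rw [← List.reverse_reverse sel, hsel, List.reverse_cons]
    have h' : (c :: b :: (vars ++ anc)).Nodup := by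
      simp only [List.nodup_cons, List.nodup_append, List.mem_cons, List.mem_append, not_or,
        List.mem_reverse, List.nodup_reverse] at h ⊢
      grind
    simp only [List.nodup_cons, List.nodup_append, List.mem_cons, List.mem_append, not_or,
        List.mem_reverse] at h
    simp only [List.length_append, List.length_reverse, List.length_cons, List.length_nil] at hl
    simp only [pull_append, pull_cons, pull_nil, pull_balancedVisit _ _ _ _ _ _ h'
      (show _ ≤ _ by omega)]
    exact pull_toffoli_toffoli _ _ _ (by grind) (by grind) _
  · rfl

theorem emit_balancedRead_xor (w : ℕ → Bool) (c : W) (sel anc : List W)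
    (h : (c :: (sel ++ anc)).Nodup) (hl : sel.length ≤ anc.length) (s s' : W → Bool)
    (hs : ∀ v ∈ sel ++ anc, s v = s' v) :
    xor (emit w (balancedRead (fun i => [i]) c sel anc) s)
        (emit w (balancedRead (fun i => [i]) c sel anc) s') =
      (xor (s c) (s' c) && w (lsbVal (sel.map s))) := by
  unfold balancedRead
  split
  · rename_i hsel
    obtain rfl : sel = [] := by simpa using hsel
    simp only [emit_load, List.map_cons, List.map_nil, xorSum_cons, xorSum_nil, lsbVal]
    generalize s c = x, s' c = y, w 0 = z
    revert x y z
    decide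
  · rename_i y vars b anc hsel
    obtain rfl : sel = vars.reverse ++ [y] := by
      rw [← List.reverse_reverse sel, hsel, List.reverse_cons]
    have h' : (c :: b :: (vars ++ anc)).Nodup := by
      simp only [List.nodup_cons, List.nodup_append, List.mem_cons, List.mem_append, not_or,
        List.mem_reverse, List.nodup_reverse] at h ⊢
      grind
    simp only [List.nodup_cons, List.nodup_append, List.mem_cons, List.mem_append, not_or,
        List.mem_reverse] at h
    simp only [List.mem_append, List.mem_reverse, List.mem_cons] at hs
    simp only [List.length_append, List.length_reverse, List.length_cons, List.length_nil] at hl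
    have hcb : c ≠ b := by grind
    have hb : ∀ v ∈ vars ++ anc, v ≠ b := by
      simp only [List.mem_append]; grind
    have hT : ∀ (r : W → Bool) (x : Bool), ∀ v ∈ vars ++ anc, Function.update r b x v = r v :=
      fun r x v hv => by simp [hb v hv]
    have key := emit_balancedVisit_xor w c b vars anc 0 h' (by omega)
      (Function.update s b (xor (s b) (s c && s y)))
      (Function.update s' b (xor (s' b) (s' c && s' y)))
      (fun v hv => by
        rw [hT _ _ v hv, hT _ _ v hv]
        simp only [List.mem_append] at hv
        grind)
    rw [map_eq_map_of_forall_mem (fun v hv => hT s _ v (List.mem_append_left _ hv)),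
      ← hs b (by simp), ← hs y (by simp)] at key
    simp only [Function.update_self, Function.update_of_ne hcb] at key
    simp only [emit_append, emit_cons_toffoli, emit_nil, pull_cons, pull_nil, Gate.pull,
      Bool.xor_false, Bool.false_xor]
    rw [← hs b (by simp), ← hs y (by simp), key, ← bitsVal_zero_reverse, ← List.map_reverse,
      List.reverse_append, List.reverse_reverse, List.reverse_singleton, List.singleton_append,
      List.map_cons, bitsVal]
    generalize s b = x1, s c = x2, s' c = x3
    cases s y <;>
    · simp only [Bool.toNat_false, Bool.toNat_true, add_zero]
      generalize w (bitsVal _ _) = y1, w (bitsVal _ _) = y2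
      revert x1 x2 x3 y1 y2
      decide
  · simp_all

end Circuit

end BalancedRead

/-! ### Subset sums of digits and their inversion mod 2. -/

/-- The parity of the weights of the labels at node `j` of a skew tree. -/
def skewSum (w : ℕ → Bool) (j : ℕ) : Bool := xorSum ((skewLabels (fun i => [i]) j).map w)

theorem skewSum_eq (w : ℕ → Bool) (j : ℕ) :
    skewSum w j = xorSum ((List.range (j + 1)).map fun i => i &&& j == i && w i) := by
  simp only [skewSum, skewLabels, List.flatMap_singleton']
  induction List.range (j + 1) with
  | nil => rfl
  | cons a L ih =>
    by_cases h : a &&& j = a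
    · simp [h, ih]
    · simp [ih, beq_false_of_ne h]

theorem xorSum_map_range_two_mul (g : ℕ → Bool) (n : ℕ) :
    xorSum ((List.range (2 * n)).map g) =
      xorSum ((List.range n).map fun i => xor (g (2 * i)) (g (2 * i + 1))) := by
  induction n with
  | zero => rfl
  | succ n ih =>
    rw [show 2 * (n + 1) = 2 * n + 1 + 1 by ring, List.range_succ, List.range_succ, List.range_succ]
    simp [ih]

theorem two_mul_add_land (i j a b : ℕ) (ha : a < 2) (hb : b < 2) :
    (2 * i + a) &&& (2 * j + b) = 2 * (i &&& j) + (a &&& b) := by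
  have hdiv : ∀ n c : ℕ, c < 2 → (2 * n + c) / 2 = n := fun n c hc => by omega
  have hab : a &&& b < 2 := Nat.and_lt_two_pow (n := 1) a hb
  refine Nat.eq_of_testBit_eq fun k => ?_
  cases k with
  | zero =>
    simp only [Nat.testBit_zero, Nat.mul_add_mod]
    interval_cases a <;> interval_cases b <;> simp
  | succ k => simp only [Nat.testBit_succ, Nat.and_div_two, hdiv _ _ ha, hdiv _ _ hb, hdiv _ _ hab]

/-- Split by the last digit of `i`: when the last digit of the node is `1`, both values are
contained in it. -/
theorem skewSum_two_mul_add_one (w : ℕ → Bool) (j : ℕ) :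
    skewSum w (2 * j + 1) = xor (skewSum (fun i => w (2 * i)) j)
      (skewSum (fun i => w (2 * i + 1)) j) := by
  simp only [skewSum_eq, ← xorSum_map_xor]
  rw [show 2 * j + 1 + 1 = 2 * (j + 1) by ring, xorSum_map_range_two_mul]
  congr 1
  refine List.map_congr_left fun i _ => ?_
  have h0 := two_mul_add_land i j 0 1 (by simp) (by simp)
  have h1 := two_mul_add_land i j 1 1 (by simp) (by simp)
  simp only [add_zero, Nat.zero_and, Nat.and_self] at h0 h1
  rw [h0, h1]
  congr 2 <;> · rw [Bool.eq_iff_iff]; simp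

theorem skewSum_two_mul (w : ℕ → Bool) (j : ℕ) :
    skewSum w (2 * j) = skewSum (fun i => w (2 * i)) j := by
  have h : ∀ i, (2 * i + 1) &&& (2 * j) ≠ 2 * i + 1 := fun i hi => by
    have := two_mul_add_land i j 1 0 (by simp) (by simp)
    simp only [add_zero, Nat.and_zero] at this
    omega
  -- The odd index `2 * j + 1` contributes nothing; including it gives a range of even length that
  -- can be paired up.
  have : skewSum w (2 * j) =
      xorSum ((List.range (2 * (j + 1))).map fun i => i &&& (2 * j) == i && w i) := by
    rw [show 2 * (j + 1) = 2 * j + 1 + 1 by ring, List.range_succ]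
    simp [skewSum_eq, beq_false_of_ne (h j)]
  rw [this, xorSum_map_range_two_mul, skewSum_eq]
  congr 1
  refine List.map_congr_left fun i _ => ?_
  have h0 := two_mul_add_land i j 0 0 (by simp) (by simp)
  simp only [add_zero, Nat.and_self] at h0
  rw [h0, beq_false_of_ne (h i), Bool.false_and, Bool.xor_false]
  congr 1
  rw [Bool.eq_iff_iff]; simp

/-- The parity of the outputs of a skew tree below node `p`, for the given digits (most significant
first): the left branch is always taken, the right branch if the digit is `1`. -/
def skewTraverse (L : ℕ → Bool) : ℕ → List Bool → Bool
  | p, [] => L p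
  | p, y :: ys => xor (skewTraverse L (2 * p) ys) (y && skewTraverse L (2 * p + 1) ys)

theorem skewTraverse_append_singleton (L : ℕ → Bool) (p : ℕ) (ys : List Bool) (z : Bool) :
    skewTraverse L p (ys ++ [z]) =
      skewTraverse (fun j => xor (L (2 * j)) (z && L (2 * j + 1))) p ys := by
  induction ys generalizing p with
  | nil => rfl
  | cons y ys ih => simp [skewTraverse, ih]

/-- Induction on the least significant digit. For digit `0` only the output at `2 j` counts, which
is the subset sum of the even part of `w`. For digit `1` the outputs at `2 j` and `2 j + 1` are
added: the even part cancels and the odd part remains. -/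
theorem skewTraverse_skewSum (w : ℕ → Bool) (L : List Bool) :
    skewTraverse (skewSum w) 0 L.reverse = w (lsbVal L) := by
  induction L generalizing w with
  | nil => simp [skewTraverse, skewSum_eq, lsbVal]
  | cons z L ih =>
    rw [List.reverse_cons, skewTraverse_append_singleton, lsbVal]
    cases z
    · simp only [Bool.false_and, Bool.xor_false, skewSum_two_mul, Bool.toNat_false, zero_add]
      exact ih fun i => w (2 * i)
    · simp only [Bool.true_and, skewSum_two_mul, skewSum_two_mul_add_one, ← Bool.xor_assoc,
        Bool.xor_self, Bool.false_xor, Bool.toNat_true, add_comm 1]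
      exact ih fun i => w (2 * i + 1)

/-! ### Traversal of the skew tree with dirty ancillae. -/

section SkewTree

variable {W ι : Type}

namespace Circuit

theorem wellFormed_skewNode (lab : ℕ → List ι) (z f c : W) (q : ℕ) (h1 : c ≠ z) (h2 : c ≠ f)
    (h3 : z ≠ f) : WellFormed (skewNode lab z f c q) := by
  simp [skewNode, Gate.WellFormed, h1, h2, h3]

theorem wellFormed_skewVisit (lab : ℕ → List ι) (z f c b : W) (vars anc : List W) (p : ℕ)
    (h : (c :: b :: z :: f :: (vars ++ anc)).Nodup) :
    WellFormed (skewVisit lab z f c b vars anc p) := by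
  fun_induction skewVisit lab z f c b vars anc p with
  | case1 =>
    simp only [List.nodup_cons, List.mem_cons, not_or] at h
    simp only [wellFormed_append]
    exact ⟨wellFormed_skewNode _ _ _ _ _ (by grind) (by grind) (by grind),
      wellFormed_skewNode _ _ _ _ _ (by grind) (by grind) (by grind)⟩
  | case2 c b p y vars e anc ih₂ ih₁ =>
    simp only [List.cons_append, List.nodup_cons, List.nodup_append, List.mem_cons,
      List.mem_append, not_or] at h ih₁ ih₂
    simp only [wellFormed_append, wellFormed_cons, wellFormed_nil, Gate.WellFormed]
    grind
  | case3 => simp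

/-- The recursion of the balanced tree, but starting from `V(0) = 2`, one Toffoli for each of the
two nodes at the bottom. -/
theorem toffoliCount_skewVisit (lab : ℕ → List ι) (z f c b : W) (vars anc : List W) (p : ℕ)
    (hl : vars.length ≤ anc.length) :
    toffoliCount (skewVisit lab z f c b vars anc p) + 3 = 5 * 2 ^ vars.length := by
  fun_induction skewVisit lab z f c b vars anc p with
  | case1 => simp [skewNode, Gate.isToffoli]
  | case2 c b p z vars e anc ih₂ ih₁ =>
    simp only [List.length_cons, add_le_add_iff_right] at hl
    specialize ih₁ hl
    specialize ih₂ hl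
    simp [Gate.isToffoli, pow_succ]
    omega
  | case3 => simp at hl

theorem le_of_mem_skewLabels {i j : ℕ} (h : i ∈ skewLabels (fun i => [i]) j) : i ≤ j := by
  simp only [skewLabels, List.flatMap_singleton', List.mem_filter, List.mem_range] at h
  omega

theorem le_of_op_mem_skewNode {z f c d : W} {q i : ℕ}
    (h : Gate.op d i ∈ skewNode (fun i => [i]) z f c q) : i ≤ 2 * q + 1 := by
  simp only [skewNode, load, List.mem_append, List.mem_map, Gate.op.injEq, List.mem_cons,
    reduceCtorEq, List.not_mem_nil, or_false] at h
  rcases h with (⟨a, ha, -, rfl⟩ | ⟨a, ha, -, rfl⟩) | ⟨a, ha, -, rfl⟩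
  all_goals have := le_of_mem_skewLabels ha; omega

theorem lt_of_op_mem_skewVisit (z f c b : W) (vars anc : List W) (p : ℕ) (d : W) (i : ℕ)
    (h : Gate.op d i ∈ skewVisit (fun i => [i]) z f c b vars anc p) :
    i < 2 ^ (vars.length + 2) * (p + 1) := by
  induction vars generalizing c b anc p with
  | nil =>
    simp only [skewVisit, List.mem_append] at h
    simp only [List.length_nil, zero_add]
    rcases h with h | h
    all_goals have := le_of_op_mem_skewNode h; omega
  | cons y vars ih =>
    match anc with
    | [] => simp [skewVisit] at h
    | e :: anc =>
      simp [skewVisit] at h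
      rw [List.length_cons, add_right_comm, pow_succ, mul_assoc]
      rcases h with h | h
      · exact (ih _ _ _ _ h).trans_le (Nat.mul_le_mul_left _ (by omega))
      · exact (ih _ _ _ _ h).trans_le (Nat.mul_le_mul_left _ (by omega))

variable [DecidableEq W]

theorem pull_skewNode (lab : ℕ → List ι) (z f c : W) (q : ℕ) (s : W → Bool) :
    pull (skewNode lab z f c q) s = Function.update s f (xor (s f) (s c && s z)) := by
  simp [skewNode, Gate.pull]

/-- The labels loaded on `f` are applied before and after its toggle, so the dirty value of `f`
cancels and only the toggle `c ∧ z` is seen. -/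
theorem emit_skewNode (w : ℕ → Bool) (z f c : W) (q : ℕ) (hc : c ≠ f) (s : W → Bool) :
    emit w (skewNode (fun i => [i]) z f c q) s =
      (s c && xor (skewSum w (2 * q)) (s z && skewSum w (2 * q + 1))) := by
  simp only [skewNode, emit_append, emit_load, emit_cons_toffoli, emit_nil, pull_load, pull_cons,
    pull_nil, Gate.pull, Function.update_self, Function.update_of_ne hc]
  simp only [← skewSum.eq_1]
  generalize s c = x1, s f = x2, s z = x3, skewSum w _ = x4, skewSum w _ = x5
  revert x1 x2 x3 x4 x5
  decide

/-- Each node adds its own value times `z` to `f`. The whole accumulated toggle collapses to one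
product, which is why a single multiply controlled NOT can undo it. -/
theorem pull_skewVisit (lab : ℕ → List ι) (z f c b : W) (vars anc : List W) (p : ℕ)
    (h : (c :: b :: z :: f :: (vars ++ anc)).Nodup) (hl : vars.length ≤ anc.length)
    (s : W → Bool) :
    pull (skewVisit lab z f c b vars anc p) s =
      Function.update s f (xor (s f) (xor (s c) (s b) && (s z && vars.all fun v => !s v))) := by
  induction vars generalizing c b anc p s with
  | nil =>
    simp only [List.nodup_cons, List.mem_cons, not_or] at h
    have hcf : c ≠ f := by grind
    have hzf : z ≠ f := by grind
    simp only [skewVisit, pull_append, pull_skewNode, Function.update_self,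
      Function.update_of_ne hcf, Function.update_of_ne hzf, Function.update_idem, List.all_nil]
    congr 1
    generalize s f = x1, s b = x2, s c = x3, s z = x4
    revert x1 x2 x3 x4
    decide
  | cons y vars ih =>
    match anc, hl with
    | e :: anc, hl =>
      simp only [List.length_cons, add_le_add_iff_right] at hl
      have h' : (b :: e :: z :: f :: (vars ++ anc)).Nodup ∧
          (c :: e :: z :: f :: (vars ++ anc)).Nodup := by
        simp only [List.cons_append, List.nodup_cons, List.nodup_append, List.mem_cons,
          List.mem_append, not_or] at h ⊢
        grind
      simp only [List.cons_append, List.nodup_cons, List.nodup_append, List.mem_cons,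
        List.mem_append, not_or] at h
      have hcb : c ≠ b := by grind
      have hce : c ≠ e := by grind
      have hcf : c ≠ f := by grind
      have hye : y ≠ e := by grind
      have hyf : y ≠ f := by grind
      have hyb : y ≠ b := by grind
      have hbe : b ≠ e := by grind
      have hbf : b ≠ f := by grind
      have hef : e ≠ f := by grind
      have hze : z ≠ e := by grind
      have hzb : z ≠ b := by grind
      have hzf : z ≠ f := by grind
      have hall : ∀ r : W → Bool, (∀ v ∈ vars, r v = s v) →
          (vars.all fun v => !r v) = (vars.all fun v => !s v) := fun r hr => by
        rw [Bool.eq_iff_iff, List.all_eq_true, List.all_eq_true]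
        exact forall₂_congr fun v hv => by rw [hr v hv]
      have hv : ∀ v ∈ vars, v ≠ e ∧ v ≠ f ∧ v ≠ b := by grind
      let T₁ := Function.update s e (xor (s e) (s b && s y))
      have e₁ : pull (skewVisit lab z f b e vars anc (2 * p + 1)) T₁ =
          Function.update T₁ f (xor (s f)
            (xor (s b) (xor (s e) (s b && s y)) && (s z && vars.all fun v => !s v))) := by
        rw [ih _ _ _ _ h'.1 hl, hall T₁ fun v hv' => by simp [T₁, hv v hv']]
        simp [T₁, hbe, hef.symm, hze]
      let T₂ := Function.update (Function.update s e (xor (s e) (s c && s y))) f (xor (s f)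
            (xor (s b) (xor (s e) (s b && s y)) && (s z && vars.all fun v => !s v)))
      have e₂ : pull ([.cnot c b, .toffoli b y e, .cnot c b] : Circuit W ι)
          (pull (skewVisit lab z f b e vars anc (2 * p + 1)) T₁) = T₂ := by
        rw [e₁]
        simp only [pull_cons, pull_nil, Gate.pull]
        funext v
        by_cases hve : v = e
        · subst hve
          simp [T₁, T₂, hcb, hce, hcf, hye, hyf, hyb, hbe, hbf, hef, Ne.symm hbe]
          generalize s v = x1, s c = x2, s b = x3, s y = x4
          revert x1 x2 x3 x4
          decide
        · by_cases hvb : v = b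
          · subst hvb
            simp [T₁, T₂, hcb, hce, hcf, hye, hyf, hyb, hbe, hbf, hef, Ne.symm hbe]
          · by_cases hvf : v = f
            · subst hvf
              simp [T₁, T₂, hvb, hve]
            · simp [T₁, T₂, hvb, hve, hvf]
      have e₃ : pull (skewVisit lab z f c e vars anc (2 * p)) T₂ =
          Function.update (Function.update s e (xor (s e) (s c && s y))) f
            (xor (s f) (xor (s c) (s b) && (s z && (y :: vars).all fun v => !s v))) := by
        rw [ih _ _ _ _ h'.2 hl, hall T₂ fun v hv' => by simp [T₂, hv v hv']]
        simp only [T₂, Function.update_idem, Function.update_self, Function.update_of_ne hcf,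
          Function.update_of_ne hce, Function.update_of_ne hef, Function.update_of_ne hzf,
          Function.update_of_ne hze, List.all_cons]
        congr 1
        -- Over 𝔽₂, `(c + e + c y) + (b + e + b y) = (c + b) (1 + y)`: the dirty value of `e` drops
        -- out and one negated digit is gained.
        generalize s f = x1, s b = x2, s c = x3, s z = x4, s e = x5, s y = x6,
          (vars.all fun v => !s v) = x7
        revert x1 x2 x3 x4 x5 x6 x7
        decide
      simp only [skewVisit, pull_append]
      rw [show pull ([.toffoli b y e] : Circuit W ι) s = T₁ from rfl, e₂, e₃]
      simp [Gate.pull, hef, hcf, hyf, hce, hye, Function.update_comm hef]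

end Circuit

end SkewTree

/-! ### The skew read: clean-up of the flag wire and the difference property. -/

section SkewRead

variable {W ι : Type}

namespace Circuit

/-- The linearity argument of the balanced tree, with the left child entered on `Δc` alone.
Agreement on `f` is deliberately not demanded: the right subtree may toggle `f` differently in the
two runs, and nodes emit independently of `f`. -/
theorem emit_skewVisit_xor [DecidableEq W] (w : ℕ → Bool) (z f c b : W) (vars anc : List W) (p : ℕ)
    (h : (c :: b :: z :: f :: (vars ++ anc)).Nodup) (hl : vars.length ≤ anc.length)
    (s s' : W → Bool) (hs : ∀ v ∈ z :: (vars ++ anc), s v = s' v) :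
    xor (emit w (skewVisit (fun i => [i]) z f c b vars anc p) s)
        (emit w (skewVisit (fun i => [i]) z f c b vars anc p) s') =
      xor (xor (s c) (s' c) && skewTraverse (skewSum w) (2 * p) (vars.map s ++ [s z]))
        (xor (s b) (s' b) && skewTraverse (skewSum w) (2 * p + 1) (vars.map s ++ [s z])) := by
  induction vars generalizing c b anc p s s' with
  | nil =>
    simp only [List.nodup_cons, List.mem_cons, not_or] at h
    have hcf : c ≠ f := by grind
    have hbf : b ≠ f := by grind
    have hzf : z ≠ f := by grind
    simp only [skewVisit, emit_append, emit_skewNode _ _ _ _ _ hcf, emit_skewNode _ _ _ _ _ hbf,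
      pull_skewNode, Function.update_of_ne hcf, Function.update_of_ne hzf, ← hs z (by simp),
      List.map_nil, List.nil_append, skewTraverse]
    generalize s b = x1, s' b = x2, s c = x3, s' c = x4, s z = x5, skewSum w _ = y1,
      skewSum w _ = y2, skewSum w _ = y3, skewSum w _ = y4
    revert x1 x2 x3 x4 x5 y1 y2 y3 y4
    decide
  | cons y vars ih =>
    match anc, hl with
    | e :: anc, hl =>
      simp only [List.length_cons, add_le_add_iff_right] at hl
      have h' : (b :: e :: z :: f :: (vars ++ anc)).Nodup ∧
          (c :: e :: z :: f :: (vars ++ anc)).Nodup := by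
        simp only [List.cons_append, List.nodup_cons, List.nodup_append, List.mem_cons,
          List.mem_append, not_or] at h ⊢
        grind
      simp only [List.cons_append, List.nodup_cons, List.nodup_append, List.mem_cons,
        List.mem_append, not_or] at h
      have hcb : c ≠ b := by grind
      have hce : c ≠ e := by grind
      have hcf : c ≠ f := by grind
      have hye : y ≠ e := by grind
      have hyf : y ≠ f := by grind
      have hyb : y ≠ b := by grind
      have hbe : b ≠ e := by grind
      have hbf : b ≠ f := by grind
      have hef : e ≠ f := by grind
      have hv : ∀ v ∈ z :: (vars ++ anc), v ≠ e ∧ v ≠ f ∧ v ≠ b := by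
        simp only [List.mem_append, List.mem_cons]
        grind
      have hsy : s' y = s y := (hs y (by simp)).symm
      have hse : s' e = s e := (hs e (by simp)).symm
      have hs' : ∀ v ∈ z :: (vars ++ anc), s v = s' v := fun v hv => hs v (by
        simp only [List.mem_append, List.mem_cons] at hv ⊢; grind)
      let T₁ : (W → Bool) → W → Bool := fun r => Function.update r e (xor (r e) (r b && r y))
      -- Unlike in the balanced tree, the right subtree has to be carried along, since it toggles
      -- `f`.
      let T₂ : (W → Bool) → W → Bool := fun r =>
        pull ([.cnot c b, .toffoli b y e, .cnot c b] : Circuit W ℕ)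
          (pull (skewVisit (fun i => [i]) z f b e vars anc (2 * p + 1)) (T₁ r))
      have hT₁b : ∀ r, T₁ r b = r b := fun r => by simp [T₁, hbe]
      have hT₁e : ∀ r, T₁ r e = xor (r e) (r b && r y) := fun r => by simp [T₁]
      have hT₁o : ∀ r, ∀ v ∈ z :: (vars ++ anc), T₁ r v = r v := fun r v hv' => by
        simp [T₁, hv v hv']
      have hT₂c : ∀ r, T₂ r c = r c := fun r => by
        simp [T₁, T₂, Gate.pull, pull_skewVisit _ _ _ _ _ _ _ _ h'.1 hl, hcb, hcf, hce]
      have hT₂e : ∀ r, T₂ r e = xor (r e) (r c && r y) := fun r => by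
        simp only [T₁, T₂, Gate.pull, pull_skewVisit _ _ _ _ _ _ _ _ h'.1 hl, pull_cons, pull_nil,
          Function.update_self, ne_eq, hcb, hcf, hce, Ne.symm hbe, hye, hyf, hyb, hbe, hbf, hef,
          not_false_eq_true, Function.update_of_ne]
        generalize r e = x1, r b = x2, r c = x3, r y = x4
        revert x1 x2 x3 x4
        decide
      have hT₂o : ∀ r, ∀ v ∈ z :: (vars ++ anc), T₂ r v = r v := fun r v hv' => by
        simp [T₁, T₂, Gate.pull, pull_skewVisit _ _ _ _ _ _ _ _ h'.1 hl, hv v hv']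
      have hemit : ∀ r, emit w (skewVisit (fun i => [i]) z f c b (y :: vars) (e :: anc) p) r =
          xor (emit w (skewVisit (fun i => [i]) z f b e vars anc (2 * p + 1)) (T₁ r))
            (emit w (skewVisit (fun i => [i]) z f c e vars anc (2 * p)) (T₂ r)) := fun r => by
        simp only [skewVisit, emit_append, emit_cons_cnot,
          emit_cons_toffoli, emit_nil, Bool.false_xor, Bool.xor_false]
        rfl
      have h₁ := ih b e anc (2 * p + 1) h'.1 hl (T₁ s) (T₁ s')
        (fun v hv => by rw [hT₁o _ v hv, hT₁o _ v hv, hs' v hv])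
      have h₂ := ih c e anc (2 * p) h'.2 hl (T₂ s) (T₂ s')
        (fun v hv => by rw [hT₂o _ v hv, hT₂o _ v hv, hs' v hv])
      have hm : ∀ v ∈ vars, v ∈ z :: (vars ++ anc) := fun v hv => by simp [hv]
      rw [map_eq_map_of_forall_mem (fun v hv => hT₁o s v (hm v hv)), hT₁b, hT₁b, hT₁e, hT₁e,
        hT₁o s z (by simp), hsy, hse] at h₁
      rw [map_eq_map_of_forall_mem (fun v hv => hT₂o s v (hm v hv)), hT₂c, hT₂c, hT₂e, hT₂e,
        hT₂o s z (by simp), hsy, hse] at h₂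
      rw [hemit, hemit, xor_xor_xor_comm, h₁, h₂, List.map_cons, List.cons_append, skewTraverse,
        skewTraverse]
      generalize s e = x1, s b = x2, s c = x3, s' b = x4, s' c = x5, s y = x6,
        skewTraverse _ _ _ = y1, skewTraverse _ _ _ = y2, skewTraverse _ _ _ = y3,
          skewTraverse _ _ _ = y4
      revert x1 x2 x3 x4 x5 x6 y1 y2 y3 y4
      decide

theorem skewRead_concat (lab : ℕ → List ι) (c z f y e : W) (vars anc : List W) :
    skewRead lab c (z :: (vars.reverse ++ [y])) (f :: e :: anc) =
      [.toffoli c y e] ++ skewVisit lab z f c e vars anc 0 ++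
        [.cnot c e] ++ vars.map Gate.x ++ mcx (e :: z :: vars) anc f ++
        vars.map Gate.x ++ [.cnot c e] ++ [.toffoli c y e] := by
  simp only [skewRead, List.reverse_append, List.reverse_reverse, List.reverse_singleton,
    List.singleton_append]

/-- The registers of a skew tree have no wire, one wire, or a least and a most significant wire. -/
theorem skewRead_cases {W : Type}
    {motive : (sel anc : List W) → sel.length ≤ anc.length → Prop}
    (zero : ∀ anc h, motive [] anc h)
    (one : ∀ z f anc h, motive [z] (f :: anc) h)
    (two : ∀ (z y : W) (vars : List W) (f e : W) (anc : List W), vars.length ≤ anc.length →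
      ∀ h, motive (z :: (vars.reverse ++ [y])) (f :: e :: anc) h)
    (sel anc : List W) (hl : sel.length ≤ anc.length) : motive sel anc hl := by
  match sel, anc, hl with
  | [], anc, hl => exact zero anc hl
  | [z], f :: anc, hl => exact one z f anc hl
  | z :: z' :: rest, f :: e :: anc, hl =>
    obtain ⟨vars, y, hy⟩ := List.eq_nil_or_concat (z' :: rest) |>.resolve_left (by simp)
    rw [List.concat_eq_append] at hy
    have hlen : vars.reverse.length ≤ anc.length := by
      have := congrArg List.length hy
      simp only [List.length_cons, List.length_append, List.length_nil, List.length_reverse]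
        at this hl ⊢
      omega
    have := two z y vars.reverse f e anc hlen
    simp only [List.reverse_reverse] at this
    convert this (by simpa [← hy] using hl)

theorem nodup_of_skewRead {c z f y e : W} {vars anc : List W}
    (h : (c :: (z :: (vars.reverse ++ [y]) ++ f :: e :: anc)).Nodup) :
    (y :: c :: e :: z :: f :: (vars ++ anc)).Nodup := by
  simp only [List.cons_append, List.nodup_cons, List.nodup_append, List.mem_cons,
    List.mem_append, not_or, List.mem_reverse, List.nodup_reverse, List.append_assoc,
    List.not_mem_nil] at h ⊢
  grind

theorem wellFormed_skewRead (lab : ℕ → List ι) (c : W) (sel anc : List W)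
    (h : (c :: (sel ++ anc)).Nodup) (hl : sel.length ≤ anc.length) :
    WellFormed (skewRead lab c sel anc) := by
  induction sel, anc, hl using skewRead_cases with
  | zero anc _ => simp [skewRead]
  | one z f anc _ =>
    simp only [List.cons_append, List.nil_append, List.nodup_cons, List.mem_cons, not_or] at h
    have hcz : c ≠ z := by grind
    have hcf : c ≠ f := by grind
    have hzf : z ≠ f := by grind
    simp [skewRead, wellFormed_skewNode, Gate.WellFormed, hcz, hcf, hzf]
  | two z y vars f e anc hl _ =>
    have h := nodup_of_skewRead h
    have h' : (f :: (e :: z :: vars ++ anc)).Nodup := by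
      simp only [List.cons_append, List.nodup_cons, List.mem_cons, not_or] at h ⊢
      grind
    rw [skewRead_concat]
    simp only [wellFormed_append, wellFormed_cons, wellFormed_nil, wellFormed_mcx _ _ _ h',
      wellFormed_skewVisit lab _ _ _ _ _ _ 0 (List.nodup_cons.1 h).2,
      Gate.WellFormed]
    simp only [List.nodup_cons, List.mem_cons, not_or] at h
    simp only [wellFormed_map_x (fun a : W => a), and_true]
    grind

theorem toffoliCount_skewRead (lab : ℕ → List ι) (c : W) (sel anc : List W)
    (hl : sel.length ≤ anc.length) :
    toffoliCount (skewRead lab c sel anc) = treeCost .skew sel.length := by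
  induction sel, anc, hl using skewRead_cases with
  | zero anc _ => simp [skewRead, treeCost]
  | one z f anc _ => simp [skewRead, treeCost, skewNode, Gate.isToffoli]
  | two z y vars f e anc hl _ =>
    have h1 := toffoliCount_skewVisit lab z f c e vars anc 0 hl
    have h2 : toffoliCount (vars.map Gate.x : Circuit W ι) = 0 := toffoliCount_map_x (fun a => a) _
    have h3 := Nat.one_le_two_pow (n := vars.length)
    have h4 : mcxCost (vars.length + 1 + 1) = mcxCost (vars.length + 2) := rfl
    rw [skewRead_concat]
    simp only [toffoliCount_append, toffoliCount_cons, toffoliCount_nil, h2,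
      toffoliCount_mcx (ι := ι) (e :: z :: vars) anc f (by simpa using hl), Gate.isToffoli,
      List.length_cons, List.length_append, List.length_reverse, List.length_nil, treeCost]
    simp only [if_true, Bool.false_eq_true, if_false, zero_add]
    omega

theorem lt_of_op_mem_skewRead (c : W) (sel anc : List W) (hl : sel.length ≤ anc.length)
    (d : W) (i : ℕ) (h : Gate.op d i ∈ skewRead (fun i => [i]) c sel anc) :
    i < 2 ^ sel.length := by
  induction sel, anc, hl using skewRead_cases with
  | zero anc _ =>
    simp only [skewRead, load, List.mem_map, Gate.op.injEq] at h
    obtain ⟨a, ha, -, rfl⟩ := h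
    have := le_of_mem_skewLabels ha
    simp
    omega
  | one z f anc _ =>
    simp [skewRead] at h
    have := le_of_op_mem_skewNode h
    simp
    omega
  | two z y vars f e anc hl _ =>
    rw [skewRead_concat] at h
    simp [op_notMem_mcx] at h
    simpa using lt_of_op_mem_skewVisit _ _ _ _ _ _ _ _ _ h

variable [DecidableEq W]

/-- The toggle of `f` here is the one in `pull_skewVisit` with `b = e`, so in the full read the two
cancel. -/
theorem pull_skewRead_tail (c z f e : W) (vars anc : List W)
    (h : (c :: e :: z :: f :: (vars ++ anc)).Nodup) (hl : vars.length ≤ anc.length)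
    (s : W → Bool) :
    pull ([.cnot c e] ++ vars.map Gate.x ++ mcx (e :: z :: vars) anc f ++
        vars.map Gate.x ++ [.cnot c e] : Circuit W ι) s =
      Function.update s f (xor (s f) (xor (s c) (s e) && (s z && vars.all fun v => !s v))) := by
  have h' : (f :: (e :: z :: vars ++ anc)).Nodup := by
    simp only [List.cons_append, List.nodup_cons, List.mem_cons, not_or] at h ⊢
    grind
  simp only [List.nodup_cons, List.nodup_append, List.mem_cons, List.mem_append, not_or] at h
  have hce : c ≠ e := by grind
  have hcf : c ≠ f := by grind
  have hef : e ≠ f := by grind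
  have hze : z ≠ e := by grind
  have hev : e ∉ vars := by grind
  have hzv : z ∉ vars := by grind
  have hconj := pull_conj_mcx (ι := ι) vars (e :: z :: vars) anc f (by grind) (by grind) h'
    (by simpa using hl)
  simp only [pull_append] at hconj
  simp only [pull_append, hconj, pull_cons, pull_nil, Gate.pull]
  have hall : (vars.all fun v => xor (Function.update s e (xor (s e) (s c)) v)
      (decide (v ∈ vars))) = vars.all fun v => !s v := by
    rw [Bool.eq_iff_iff, List.all_eq_true, List.all_eq_true]
    refine forall₂_congr fun v hv => ?_
    have : v ≠ e := fun hve => hev (hve ▸ hv)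
    simp [this, hv]
  simp only [List.all_cons, hall, hev, hzv, decide_false, Bool.xor_false, Function.update_self,
    Function.update_of_ne hze, Function.update_of_ne hef.symm, Function.update_of_ne hef,
    Function.update_of_ne hce, Function.update_of_ne hcf]
  rw [Function.update_comm hef.symm, Function.update_idem]
  rw [Bool.xor_assoc, Bool.xor_self, Bool.xor_false, Function.update_eq_self,
    Bool.xor_comm (s e)]

theorem pull_skewRead (lab : ℕ → List ι) (c : W) (sel anc : List W)
    (h : (c :: (sel ++ anc)).Nodup) (hl : sel.length ≤ anc.length) (s : W → Bool) :
    pull (skewRead lab c sel anc) s = s := by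
  induction sel, anc, hl using skewRead_cases with
  | zero anc _ => simp [skewRead]
  | one z f anc _ =>
    simp only [List.cons_append, List.nil_append, List.nodup_cons, List.mem_cons, not_or] at h
    have hcf : c ≠ f := by grind
    have hzf : z ≠ f := by grind
    simp [skewRead, pull_skewNode, Gate.pull, hcf, hzf]
  | two z y vars f e anc hl _ =>
    have h := nodup_of_skewRead h
    have h' := (List.nodup_cons.1 h).2
    have htail := pull_skewRead_tail (ι := ι) c z f e vars anc h' hl
    simp only [pull_append] at htail
    rw [skewRead_concat]
    simp only [pull_append, htail, pull_skewVisit _ _ _ _ _ _ _ _ h' hl]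
    simp only [List.nodup_cons, List.nodup_append, List.mem_cons, List.mem_append, not_or] at h
    have hce : c ≠ e := by grind
    have hcf : c ≠ f := by grind
    have hef : e ≠ f := by grind
    have hzf : z ≠ f := by grind
    have hye : y ≠ e := by grind
    have hall : ∀ (r : W → Bool) (x : Bool), (vars.all fun v => !(Function.update r f x v)) =
        vars.all fun v => !r v := fun r x => by
      rw [Bool.eq_iff_iff, List.all_eq_true, List.all_eq_true]
      refine forall₂_congr fun v hv => ?_
      have : v ≠ f := by grind
      simp [this]
    simp only [hall, Function.update_self, Function.update_of_ne hcf, Function.update_of_ne hef,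
      Function.update_of_ne hzf, Function.update_idem, Bool.xor_assoc, Bool.xor_self,
      Bool.xor_false, Function.update_eq_self]
    exact pull_toffoli_toffoli (ι := ι) c y e hce hye s

theorem emit_skewRead_xor (w : ℕ → Bool) (c : W) (sel anc : List W)
    (h : (c :: (sel ++ anc)).Nodup) (hl : sel.length ≤ anc.length) (s s' : W → Bool)
    (hs : ∀ v ∈ sel ++ anc, s v = s' v) :
    xor (emit w (skewRead (fun i => [i]) c sel anc) s)
        (emit w (skewRead (fun i => [i]) c sel anc) s') =
      (xor (s c) (s' c) && w (lsbVal (sel.map s))) := by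
  rw [← skewTraverse_skewSum w]
  induction sel, anc, hl using skewRead_cases with
  | zero anc _ =>
    simp only [skewRead, emit_load, ← skewSum.eq_1, List.map_nil, List.reverse_nil, skewTraverse]
    generalize s c = x, s' c = y, skewSum w 0 = z
    revert x y z
    decide
  | one z f anc _ =>
    simp only [List.cons_append, List.nil_append, List.nodup_cons, List.mem_cons, not_or] at h
    have hcf : c ≠ f := by grind
    have hzf : z ≠ f := by grind
    simp only [skewRead, List.reverse_nil, emit_append, emit_skewNode _ _ _ _ _ hcf,
      emit_cons_toffoli, emit_nil, pull_cons, pull_nil, Gate.pull, Function.update_of_ne hcf,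
      Function.update_of_ne hzf, ← hs z (by simp), List.map_cons, List.map_nil,
      List.reverse_singleton, skewTraverse]
    generalize s c = x1, s' c = x2, s z = x3, skewSum w _ = y1, skewSum w _ = y2
    revert x1 x2 x3 y1 y2
    decide
  | two z y vars f e anc hl _ =>
    have h := nodup_of_skewRead h
    have h' := (List.nodup_cons.1 h).2
    simp only [List.cons_append, List.mem_append, List.mem_reverse, List.mem_cons] at hs
    simp only [List.nodup_cons, List.nodup_append, List.mem_cons, List.mem_append, not_or] at h
    have hce : c ≠ e := by grind
    have hcf : c ≠ f := by grind
    have hef : e ≠ f := by grind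
    let T : (W → Bool) → W → Bool := fun r =>
      pull ([.cnot c e] ++ vars.map Gate.x ++ mcx (e :: z :: vars) anc f ++
        vars.map Gate.x ++ [.cnot c e] : Circuit W ℕ)
        (Function.update r e (xor (r e) (r c && r y)))
    have htail := pull_skewRead_tail (ι := ℕ) c z f e vars anc h' hl
    have hTc : ∀ r, T r c = r c := fun r => by simp only [T, htail]; simp [hcf, hce]
    have hTe : ∀ r, T r e = xor (r e) (r c && r y) := fun r => by
      simp only [T, htail]; simp [hef]
    have hTo : ∀ r, ∀ v ∈ z :: (vars ++ anc), T r v = r v := fun r v hv => by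
      have h1 : v ≠ e ∧ v ≠ f := by
        simp only [List.mem_append, List.mem_cons] at hv
        grind
      simp only [T, htail]
      simp [h1]
    have key := emit_skewVisit_xor w z f c e vars anc 0 h' hl (T s) (T s') (fun v hv => by
      rw [hTo _ v hv, hTo _ v hv]
      simp only [List.mem_append, List.mem_cons] at hv
      grind)
    rw [map_eq_map_of_forall_mem (fun v hv => hTo s v (by simp [hv])), hTc, hTc, hTe, hTe,
      hTo s z (by simp), ← hs y (by simp), ← hs e (by simp)] at key
    have hemit : ∀ r, emit w (skewRead (fun i => [i]) c (z :: (vars.reverse ++ [y]))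
        (f :: e :: anc)) r = emit w (skewVisit (fun i => [i]) z f c e vars anc 0) (T r) := by
      intro r
      rw [skewRead_concat]
      simp only [T, emit_append, pull_append, emit_cons_cnot, emit_cons_toffoli, emit_nil, emit_mcx,
        emit_map_x, Bool.false_xor, Bool.xor_false]
      rfl
    rw [hemit, hemit, key]
    simp only [List.map_cons, List.map_append, List.map_reverse, List.map_nil, List.reverse_cons,
      List.reverse_append, List.reverse_reverse, List.reverse_nil, List.nil_append,
      List.cons_append, skewTraverse]
    generalize s e = x1, s c = x2, s' c = x3, s y = x4, skewTraverse _ _ _ = y1,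
      skewTraverse _ _ _ = y2
    revert x1 x2 x3 x4 y1 y2
    decide

end Circuit

end SkewRead

/-! ### Common properties of both kinds of read. -/

section TreeRead

variable {W ι : Type}

namespace Circuit

theorem wellFormed_treeRead (τ : TreeShape) (lab : ℕ → List ι) (c : W) (sel anc : List W)
    (h : (c :: (sel ++ anc)).Nodup) (hl : sel.length ≤ anc.length) :
    WellFormed (treeRead τ lab c sel anc) := by
  cases τ with
  | balanced => exact wellFormed_balancedRead lab c sel anc h
  | skew => exact wellFormed_skewRead lab c sel anc h hl

theorem toffoliCount_treeRead (τ : TreeShape) (lab : ℕ → List ι) (c : W) (sel anc : List W)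
    (hl : sel.length ≤ anc.length) :
    toffoliCount (treeRead τ lab c sel anc) = treeCost τ sel.length := by
  cases τ with
  | balanced => exact toffoliCount_balancedRead lab c sel anc hl
  | skew => exact toffoliCount_skewRead lab c sel anc hl

theorem exists_of_op_mem_treeRead (τ : TreeShape) (lab : ℕ → List ι) (c : W) (sel anc : List W)
    (hl : sel.length ≤ anc.length) (d : W) (l : ι) (h : Gate.op d l ∈ treeRead τ lab c sel anc) :
    ∃ i < 2 ^ sel.length, l ∈ lab i := by
  rw [treeRead_eq_flatMap] at h
  obtain ⟨i, hi, hl'⟩ := exists_op_of_mem_flatMap_relabel lab _ d l h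
  refine ⟨i, ?_, hl'⟩
  cases τ with
  | balanced => exact lt_of_op_mem_balancedRead c sel anc d i hi
  | skew => exact lt_of_op_mem_skewRead c sel anc hl d i hi

variable [DecidableEq W]

theorem pull_treeRead (τ : TreeShape) (lab : ℕ → List ι) (c : W) (sel anc : List W)
    (h : (c :: (sel ++ anc)).Nodup) (hl : sel.length ≤ anc.length) (s : W → Bool) :
    pull (treeRead τ lab c sel anc) s = s := by
  cases τ with
  | balanced => exact pull_balancedRead lab c sel anc h hl s
  | skew => exact pull_skewRead lab c sel anc h hl s

theorem emit_treeRead (τ : TreeShape) (lab : ℕ → List ι) (w : ι → Bool) (c : W) (sel anc : List W)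
    (s : W → Bool) : emit w (treeRead τ lab c sel anc) s =
      emit (fun i => xorSum ((lab i).map w)) (treeRead τ (fun i => [i]) c sel anc) s := by
  rw [treeRead_eq_flatMap, emit_flatMap_relabel]

/-- Toggling the control of a dirty read changes what it applies by exactly the selected label. -/
theorem emit_treeRead_update (τ : TreeShape) (w : ℕ → Bool) (c : W) (sel anc : List W)
    (h : (c :: (sel ++ anc)).Nodup) (hl : sel.length ≤ anc.length) (s : W → Bool) (t : Bool) :
    emit w (treeRead τ (fun i => [i]) c sel anc) (Function.update s c (xor (s c) t)) =
      xor (emit w (treeRead τ (fun i => [i]) c sel anc) s) (t && w (lsbVal (sel.map s))) := by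
  have hs : ∀ v ∈ sel ++ anc, s v = Function.update s c (xor (s c) t) v := fun v hv => by
    rw [Function.update_of_ne]
    rintro rfl
    exact (List.nodup_cons.1 h).1 hv
  have key : xor (emit w (treeRead τ (fun i => [i]) c sel anc) s)
      (emit w (treeRead τ (fun i => [i]) c sel anc) (Function.update s c (xor (s c) t))) =
      (xor (s c) (Function.update s c (xor (s c) t) c) && w (lsbVal (sel.map s))) := by
    cases τ with
    | balanced => exact emit_balancedRead_xor w c sel anc h hl _ _ hs
    | skew => exact emit_skewRead_xor w c sel anc h hl _ _ hs
  rw [Function.update_self] at key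
  clear hs
  revert key
  generalize Function.update s c (xor (s c) t) = s'
  generalize emit w (treeRead τ (fun i => [i]) c sel anc) s' = x,
    emit w (treeRead τ (fun i => [i]) c sel anc) s = y, s c = z, w _ = u
  revert x y z u t
  decide

end Circuit

end TreeRead

/-! ### Cancelling the garbage of all the trees with one extra read. -/

section SplitIteration

variable {W : Type}

/-- The circuit of `dirtyUnaryIteration` on given registers. -/
def splitIteration (τ : TreeShape) (bottom top : List W) (root : W) (anc : List W) : Circuit W ℕ :=
  (List.range (2 ^ top.length)).flatMap (fun j =>
    toggleOn top anc root j ++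
      treeRead τ (fun i => [j * 2 ^ bottom.length + i]) root bottom anc ++
      toggleOn top anc root j) ++
  treeRead τ (fun i => (List.range (2 ^ top.length)).map (fun j => j * 2 ^ bottom.length + i))
    root bottom anc

namespace Circuit

variable {τ : TreeShape} {bottom top : List W} {root : W} {anc : List W}

theorem nodup_root_top_anc (h : (root :: (bottom ++ top ++ anc)).Nodup) :
    (root :: (top ++ anc)).Nodup ∧ (root :: (bottom ++ anc)).Nodup := by
  simp only [List.nodup_cons, List.nodup_append, List.mem_append, not_or] at h ⊢
  grind

theorem wellFormed_splitIteration (h : (root :: (bottom ++ top ++ anc)).Nodup)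
    (hb : bottom.length ≤ anc.length) : WellFormed (splitIteration τ bottom top root anc) := by
  obtain ⟨h1, h2⟩ := nodup_root_top_anc h
  simp only [splitIteration, wellFormed_append, wellFormed_flatMap,
    wellFormed_toggleOn _ _ _ _ h1, wellFormed_treeRead _ _ _ _ _ h2 hb, and_self, implies_true]

theorem toffoliCount_splitIteration (hb : bottom.length ≤ anc.length)
    (ht : top.length ≤ anc.length + 2) :
    toffoliCount (splitIteration τ bottom top root anc) =
      2 ^ top.length * (2 * mcxCost top.length + treeCost τ bottom.length) +
        treeCost τ bottom.length := by
  rw [splitIteration, toffoliCount_append, toffoliCount_treeRead _ _ _ _ _ hb, toffoliCount,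
    List.countP_flatMap]
  congr 1
  rw [List.map_congr_left (g := fun _ => 2 * mcxCost top.length + treeCost τ bottom.length)]
  · simp
  · intro j _
    have := toffoliCount_append (toggleOn top anc root j ++
      treeRead τ (fun i => [j * 2 ^ bottom.length + i]) root bottom anc) (toggleOn top anc root j)
    rw [toffoliCount_append (toggleOn top anc root j), toffoliCount_toggleOn _ _ _ _ ht,
      toffoliCount_treeRead _ _ _ _ _ hb] at this
    refine Eq.trans this ?_
    ring

theorem lt_of_op_mem_splitIteration (hb : bottom.length ≤ anc.length) (c : W) (i : ℕ)
    (h : Gate.op c i ∈ splitIteration τ bottom top root anc) :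
    i < 2 ^ (bottom.length + top.length) := by
  have key : ∀ j < 2 ^ top.length, ∀ i < 2 ^ bottom.length,
      j * 2 ^ bottom.length + i < 2 ^ (bottom.length + top.length) := fun j hj i hi => by
    have := Nat.mul_le_mul_right (2 ^ bottom.length) (Nat.succ_le_of_lt hj)
    rw [Nat.succ_mul] at this
    rw [pow_add, mul_comm (2 ^ bottom.length)]
    omega
  simp only [splitIteration, List.mem_append, List.mem_flatMap, List.mem_range,
    op_notMem_toggleOn, false_or, or_false] at h
  rcases h with ⟨j, hj, h⟩ | h
  · obtain ⟨i', hi', h⟩ := exists_of_op_mem_treeRead τ _ _ _ _ hb _ _ h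
    rw [List.mem_singleton] at h
    exact h ▸ key j hj i' hi'
  · obtain ⟨i', hi', h⟩ := exists_of_op_mem_treeRead τ _ _ _ _ hb _ _ h
    obtain ⟨j, hj, rfl⟩ := List.mem_map.1 h
    exact key j (List.mem_range.1 hj) i' hi'

variable [DecidableEq W]

theorem pull_iteration_block (h : (root :: (bottom ++ top ++ anc)).Nodup)
    (hb : bottom.length ≤ anc.length) (ht : top.length ≤ anc.length + 2) {j : ℕ}
    (hj : j < 2 ^ top.length) (lab : ℕ → List ℕ) (s : W → Bool) :
    pull (toggleOn top anc root j ++ treeRead τ lab root bottom anc ++ toggleOn top anc root j) s =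
      s := by
  obtain ⟨h1, h2⟩ := nodup_root_top_anc h
  simp only [pull_append, pull_treeRead _ _ _ _ _ h2 hb, pull_toggleOn _ _ _ _ h1 ht hj]
  have : top.map (Function.update s root (xor (s root) (decide (lsbVal (top.map s) = j)))) =
      top.map s := map_eq_map_of_forall_mem fun v hv => Function.update_of_ne (by
        rintro rfl
        exact (List.nodup_cons.1 h1).1 (List.mem_append_left _ hv)) _ _
  rw [this]
  simp

theorem pull_splitIteration (h : (root :: (bottom ++ top ++ anc)).Nodup)
    (hb : bottom.length ≤ anc.length) (ht : top.length ≤ anc.length + 2) (s : W → Bool) :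
    pull (splitIteration τ bottom top root anc) s = s := by
  rw [splitIteration, pull_append, pull_treeRead _ _ _ _ _ (nodup_root_top_anc h).2 hb,
    pull_flatMap_of_pull_eq]
  exact fun j hj s => pull_iteration_block h hb ht (List.mem_range.1 hj) _ s

theorem emit_splitIteration (h : (root :: (bottom ++ top ++ anc)).Nodup)
    (hb : bottom.length ≤ anc.length) (ht : top.length ≤ anc.length + 2) (w : ℕ → Bool)
    (s : W → Bool) :
    emit w (splitIteration τ bottom top root anc) s = w (lsbVal ((bottom ++ top).map s)) := by
  obtain ⟨h1, h2⟩ := nodup_root_top_anc h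
  rw [splitIteration, emit_append, pull_treeRead _ _ _ _ _ h2 hb, emit_flatMap_of_pull_eq _ _
    fun j hj s => pull_iteration_block h hb ht (List.mem_range.1 hj) _ s]
  -- Block `j` emits what its tree emits with the root untoggled, plus the selected weight if the
  -- top register holds `j`.
  rw [List.map_congr_left (g := fun j =>
    xor (emit (fun i => w (j * 2 ^ bottom.length + i)) (treeRead τ (fun i => [i]) root bottom anc) s)
      (decide (lsbVal (top.map s) = j) &&
        w (j * 2 ^ bottom.length + lsbVal (bottom.map s))))]
  · have hlt : lsbVal (top.map s) < 2 ^ top.length := by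
      simpa using lsbVal_lt (top.map s)
    rw [xorSum_map_xor, xorSum_map_range_single _ _
      fun j => w (j * 2 ^ bottom.length + lsbVal (bottom.map s)), emit_treeRead]
    simp only [List.map_map, Function.comp_def]
    -- The last read runs from the same state with the untoggled root, so its emission is exactly
    -- the sum of the garbage terms.
    rw [emit_xorSum _ fun j i => w (j * 2 ^ bottom.length + i), ← Bool.xor_assoc, Bool.xor_self,
      Bool.false_xor, decide_eq_true hlt, Bool.true_and, List.map_append, lsbVal_append,
      List.length_map, add_comm, mul_comm]
  · intro j hj
    rw [emit_append, emit_append, emit_toggleOn, emit_toggleOn, Bool.false_xor, Bool.xor_false,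
      pull_toggleOn _ _ _ _ h1 ht (List.mem_range.1 hj), emit_treeRead,
      emit_treeRead_update _ _ _ _ _ h2 hb]
    simp

end Circuit

end SplitIteration

/-! ### Compilation to a QROM. -/

section QROM

variable {W : Type} {w : ℕ}

namespace Circuit

theorem wellFormed_flatMap_toQROM (data : ℕ → Fin w → Bool) (C : Circuit W ℕ)
    (hC : C.WellFormed) : WellFormed (C.flatMap (Gate.toQROM data)) := by
  rw [wellFormed_flatMap]
  intro g hg
  have := hC g hg
  cases g with
  | op c i => simp [Gate.toQROM, WellFormed, Gate.WellFormed]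
  | _ => simp_all [Gate.toQROM, Gate.WellFormed]

theorem toffoliCount_flatMap_toQROM (data : ℕ → Fin w → Bool) (C : Circuit W ℕ) :
    toffoliCount (C.flatMap (Gate.toQROM data)) = C.toffoliCount := by
  induction C with
  | nil => rfl
  | cons g C ih =>
    rw [List.flatMap_cons, toffoliCount_append, ih, toffoliCount_cons, add_comm]
    congr 1
    cases g with
    | op c i => simp [Gate.toQROM, toffoliCount, Gate.isToffoli]
    | _ => simp [Gate.toQROM, Gate.isToffoli]

variable [DecidableEq W]

theorem pull_map_cnot (c : W) (R : List (Fin w)) (hR : R.Nodup) (s : W → Bool)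
    (t : Fin w → Bool) :
    pull (R.map fun r => (Gate.cnot (.inl c) (.inr r) : Gate (W ⊕ Fin w) Empty)) (Sum.elim s t) =
      Sum.elim s (fun r => xor (t r) (decide (r ∈ R) && s c)) := by
  induction R with
  | nil => simp
  | cons a R ih =>
    rw [List.nodup_cons] at hR
    rw [List.map_cons, pull_cons, ih hR.2, Gate.pull]
    funext v
    rcases v with v | r
    · simp
    · by_cases hr : r = a
      · subst hr
        simp [hR.1]
      · simp [hr]

/-- Target bit `r` is toggled by the parity of the `r`-th data bits met, which is `emit` for the
weight `fun i => data i r`. -/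
theorem pull_flatMap_toQROM (data : ℕ → Fin w → Bool) (C : Circuit W ℕ) (s : W → Bool)
    (t : Fin w → Bool) :
    pull (C.flatMap (Gate.toQROM data)) (Sum.elim s t) =
      Sum.elim (pull C s) (fun r => xor (t r) (emit (fun i => data i r) C s)) := by
  induction C with
  | nil => simp
  | cons g C ih =>
    rw [List.flatMap_cons, pull_append, ih]
    cases g with
    | op c i =>
      rw [Gate.toQROM, pull_map_cnot _ _ ((List.nodup_finRange w).filter _)]
      simp [Gate.pull, Bool.and_comm]
    | _ =>
      simp only [Gate.toQROM, pull_cons, pull_nil, emit_cons_x, emit_cons_cnot, emit_cons_toffoli,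
        Gate.pull, Sum.elim_inl, Sum.update_elim_inl]

theorem run_empty {W' : Type} [DecidableEq W'] (C : Circuit W' Empty) {H : Type u}
    [NormedAddCommGroup H] [InnerProductSpace ℂ H] (U : Empty → (H ≃ₗᵢ[ℂ] H)) (ψ : QState W' H)
    (s : W' → Bool) : C.run U ψ s = ψ (pull C s) := by
  rw [run_apply]
  have : labels C s = [] := List.eq_nil_iff_forall_not_mem.2 fun a => a.elim
  simp [this]

end Circuit

end QROM

/-! ### The concrete registers and the cost estimates. -/

theorem lsbVal_map_finRange {n : ℕ} (f : Fin n → Bool) :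
    lsbVal ((List.finRange n).map f) = Nat.ofBits f := by
  refine Nat.eq_of_testBit_eq fun i => ?_
  by_cases hi : i < n
  · rw [testBit_lsbVal _ _ (by simpa using hi), Nat.testBit_ofBits_lt _ _ hi]
    simp
  · have h1 := lsbVal_lt ((List.finRange n).map f)
    simp only [List.length_map, List.length_finRange] at h1
    rw [Nat.testBit_ofBits_ge _ _ (not_lt.1 hi), Nat.testBit_lt_two_pow
      (h1.trans_le (Nat.pow_le_pow_right (by simp) (not_lt.1 hi)))]

/-- The registers of `dirtyUnaryIteration`. -/
theorem exists_dirtyUnaryIteration_eq (n k : ℕ) (hk : 1 ≤ k) (hkn : k ≤ n) :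
    ∃ (bottom top : List (Wire n)) (root : Wire n) (anc : List (Wire n)),
      bottom ++ top = (List.finRange n).map Wire.sel ∧ bottom.length = n - k ∧ top.length = k ∧
      (root :: (bottom ++ top ++ anc)).Nodup ∧ bottom.length ≤ anc.length ∧
      top.length ≤ anc.length + 2 ∧
      ∀ τ, dirtyUnaryIteration τ n k = splitIteration τ bottom top root anc := by
  obtain ⟨n, rfl⟩ : ∃ m, n = m + 1 := ⟨n - 1, by omega⟩
  have hanc : (List.finRange (n + 1)).map Wire.anc =
      Wire.anc 0 :: (List.finRange n).map (fun q => Wire.anc q.succ) := by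
    simp [List.finRange_succ, Function.comp_def]
  have hbl : (((List.finRange (n + 1)).map Wire.sel).take (n + 1 - k)).length = n + 1 - k := by
    simp
  have htl : (((List.finRange (n + 1)).map Wire.sel).drop (n + 1 - k)).length = k := by
    simp
    omega
  refine ⟨((List.finRange (n + 1)).map Wire.sel).take (n + 1 - k),
    ((List.finRange (n + 1)).map Wire.sel).drop (n + 1 - k), Wire.anc 0,
    (List.finRange n).map (fun q => Wire.anc q.succ), List.take_append_drop _ _, hbl, htl, ?_,
    ?_, ?_, ?_⟩
  · rw [List.take_append_drop]
    have h1 : ((List.finRange (n + 1)).map (Wire.sel (n := n + 1))).Nodup :=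
      (List.nodup_finRange _).map fun a b h => by simpa using h
    have h2 : ((List.finRange (n + 1)).map (Wire.anc (n := n + 1))).Nodup :=
      (List.nodup_finRange _).map fun a b h => by simpa using h
    rw [hanc] at h2
    have h3 := List.nodup_cons.1 h2
    rw [List.nodup_cons, List.nodup_append]
    refine ⟨?_, h1, h3.2, ?_⟩
    · rw [List.mem_append, not_or]
      exact ⟨by simp, h3.1⟩
    · rintro a ha b hb rfl
      simp only [List.mem_map] at ha hb
      obtain ⟨q, -, rfl⟩ := ha
      obtain ⟨q', -, h⟩ := hb
      cases h
  -- One ancilla is spent on the root; the others suffice for the bottom register because `1 ≤ k`.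
  · rw [hbl]
    simp
    omega
  · rw [htl]
    simp
    omega
  · intro τ
    simp only [dirtyUnaryIteration, splitIteration, hanc, hbl, htl]

theorem toffoliCount_dirtyUnaryIteration (τ : TreeShape) (n k : ℕ) (hk : 1 ≤ k) (hkn : k ≤ n) :
    (dirtyUnaryIteration τ n k).toffoliCount =
      2 ^ k * (2 * Circuit.mcxCost k + Circuit.treeCost τ (n - k)) +
        Circuit.treeCost τ (n - k) := by
  obtain ⟨bottom, top, root, anc, -, hbl, htl, -, hb, ht, h⟩ :=
    exists_dirtyUnaryIteration_eq n k hk hkn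
  rw [h, Circuit.toffoliCount_splitIteration hb ht, hbl, htl]

theorem dirtyReadCost_eq (τ : TreeShape) (m : ℕ) : dirtyReadCost τ m = Circuit.treeCost τ m := by
  rw [dirtyReadCost, Circuit.toffoliCount_treeRead _ _ _ _ _ (by simp)]
  simp

theorem abs_treeCost_balanced_sub_le (m : ℕ) :
    |(Circuit.treeCost .balanced m : ℝ) - 1.5 * 2 ^ m| ≤ 4 * m + 2 := by
  cases m with
  | zero => norm_num [Circuit.treeCost]
  | succ m =>
    have h : Circuit.treeCost .balanced (m + 1) + 1 = 3 * 2 ^ m := by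
      have := Nat.one_le_two_pow (n := m)
      simp only [Circuit.treeCost]
      omega
    have h' : (Circuit.treeCost .balanced (m + 1) : ℝ) = 3 * 2 ^ m - 1 := by
      rw [eq_sub_iff_add_eq]
      exact_mod_cast h
    have hm : (0 : ℝ) ≤ m := m.cast_nonneg
    rw [h', pow_succ, abs_le]
    push_cast
    constructor <;> linarith

/-- The term `4 * m` pays for the final multiply controlled NOT; the `2` covers the cases `m = 0,
1`, which do not follow the general formula. -/
theorem abs_treeCost_skew_sub_le (m : ℕ) :
    |(Circuit.treeCost .skew m : ℝ) - 1.25 * 2 ^ m| ≤ 4 * m + 2 := by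
  match m with
  | 0 => norm_num [Circuit.treeCost]
  | 1 => norm_num [Circuit.treeCost, abs_le]
  | m + 2 =>
    have h : Circuit.treeCost .skew (m + 2) + 1 = 5 * 2 ^ m + Circuit.mcxCost (m + 2) := by
      have := Nat.one_le_two_pow (n := m)
      simp only [Circuit.treeCost]
      omega
    have h' : (Circuit.treeCost .skew (m + 2) : ℝ) = 5 * 2 ^ m + Circuit.mcxCost (m + 2) - 1 := by
      rw [eq_sub_iff_add_eq]
      exact_mod_cast h
    have h1 : (Circuit.mcxCost (m + 2) : ℝ) ≤ 4 * (m + 2 : ℕ) := by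
      exact_mod_cast Circuit.mcxCost_le (m + 2)
    have h0 : (0 : ℝ) ≤ Circuit.mcxCost (m + 2) := Nat.cast_nonneg _
    have hm : (0 : ℝ) ≤ m := m.cast_nonneg
    rw [h', pow_add, abs_le]
    push_cast at h1 ⊢
    constructor <;> linarith

/-- The factor `2` absorbs the rounding of `n / 2` for odd `n`. -/
theorem two_pow_le_two_mul_sqrt {n j : ℕ} (h : 2 * j ≤ n + 1) :
    (2 : ℝ) ^ j ≤ 2 * Real.sqrt (2 ^ n) := by
  have h2 : ((2 : ℝ) ^ j) ^ 2 ≤ 2 ^ 2 * 2 ^ n := by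
    rw [← pow_mul, ← pow_add]
    exact pow_le_pow_right₀ (by norm_num) (by omega)
  have := Real.le_sqrt_of_sq_le h2
  rwa [Real.sqrt_mul (by positivity), Real.sqrt_sq (by norm_num)] at this

theorem abs_split_cost_sub_le {n k : ℕ} (hk : 1 ≤ k) (h : k = n / 2 ∨ k = (n + 1) / 2)
    {a X D : ℝ} (ha0 : 0 ≤ a) (ha : a ≤ 2) (hX : |X - (2 ^ k + 1) * D| ≤ 8 * (2 ^ k * k))
    (hD : |D - a * 2 ^ (n - k)| ≤ 4 * (n - k : ℕ) + 2) :
    |X - a * 2 ^ n| ≤ 44 * (n * Real.sqrt (2 ^ n)) := by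
  have hkn : k ≤ n := by omega
  have hK := two_pow_le_two_mul_sqrt (n := n) (j := k) (by omega)
  have hM := two_pow_le_two_mul_sqrt (n := n) (j := n - k) (by omega)
  have hpow : (2 : ℝ) ^ n = 2 ^ k * 2 ^ (n - k) := by rw [← pow_add]; congr 1; omega
  have hmn : ((n - k : ℕ) : ℝ) ≤ n := by exact_mod_cast Nat.sub_le n k
  have hkn' : (k : ℝ) ≤ n := by exact_mod_cast hkn
  have hn : (1 : ℝ) ≤ n := by exact_mod_cast hk.trans hkn
  have hK1 : (1 : ℝ) ≤ 2 ^ k := one_le_pow₀ (by norm_num)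
  set r := Real.sqrt (2 ^ n)
  have hr : 0 ≤ r := Real.sqrt_nonneg _
  -- Three errors: the root toggles, the lower-order part of each read, and the leading part of the
  -- one extra read. Against `n * r` they cost `16`, `24` and `4`, in total `44`.
  have e : X - a * 2 ^ n = (X - (2 ^ k + 1) * D) +
      ((2 ^ k + 1) * (D - a * 2 ^ (n - k)) + a * 2 ^ (n - k)) := by rw [hpow]; ring
  have b1 : (8 : ℝ) * (2 ^ k * k) ≤ 8 * (2 * r * n) := by gcongr
  have b2 : |((2 : ℝ) ^ k + 1) * (D - a * 2 ^ (n - k))| ≤ (4 * r) * (6 * n) := by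
    rw [abs_mul, abs_of_nonneg (by positivity)]
    exact mul_le_mul (by linarith) (hD.trans (by linarith)) (abs_nonneg _) (by positivity)
  have b3 : |a * (2 : ℝ) ^ (n - k)| ≤ 2 * (2 * r) := by
    rw [abs_of_nonneg (by positivity)]
    gcongr
  have b4 : r ≤ n * r := le_mul_of_one_le_left hr hn
  calc |X - a * 2 ^ n| ≤ |X - (2 ^ k + 1) * D| +
        (|(2 ^ k + 1) * (D - a * 2 ^ (n - k))| + |a * 2 ^ (n - k)|) := by
        rw [e]
        exact (abs_add_le _ _).trans (by gcongr; exact abs_add_le _ _)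
    _ ≤ 8 * (2 * r * n) + ((4 * r) * (6 * n) + 2 * (2 * r)) := by
        gcongr
        exact hX.trans b1
    _ ≤ 44 * (n * r) := by linarith

/-- The difference is exactly the cost of the root toggles: two in each of the `2 ^ k` blocks, at
most `4 * k` Toffolis each. -/
theorem abs_toffoliCount_sub_le (τ : TreeShape) (n k : ℕ) (hk : 1 ≤ k) (hkn : k ≤ n) :
    |((dirtyUnaryIteration τ n k).toffoliCount : ℝ) -
      (2 ^ k + 1) * (dirtyReadCost τ (n - k) : ℝ)| ≤ 8 * (2 ^ k * k) := by
  rw [toffoliCount_dirtyUnaryIteration τ n k hk hkn, dirtyReadCost_eq]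
  have h : (Circuit.mcxCost k : ℝ) ≤ 4 * k := by exact_mod_cast Circuit.mcxCost_le k
  have h0 : (0 : ℝ) ≤ Circuit.mcxCost k := Nat.cast_nonneg _
  have e : ((2 ^ k * (2 * Circuit.mcxCost k + Circuit.treeCost τ (n - k)) +
      Circuit.treeCost τ (n - k) : ℕ) : ℝ) - (2 ^ k + 1) * (Circuit.treeCost τ (n - k) : ℝ) =
      2 * (2 ^ k * Circuit.mcxCost k) := by
    push_cast
    ring
  rw [e, abs_of_nonneg (by positivity)]
  have := mul_le_mul_of_nonneg_left h (show (0 : ℝ) ≤ 2 ^ k by positivity)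
  linarith

theorem dirtyUnaryIteration_correct (τ : TreeShape) (n k : ℕ) (hk : 1 ≤ k) (hkn : k ≤ n) :
    (dirtyUnaryIteration τ n k).WellFormed ∧
    (∀ c i, Gate.op c i ∈ dirtyUnaryIteration τ n k → i < 2 ^ n) ∧
    (∀ s, Circuit.pull (dirtyUnaryIteration τ n k) s = s) ∧
    ∀ w s, Circuit.emit w (dirtyUnaryIteration τ n k) s =
      w (Nat.ofBits fun q : Fin n => s (Wire.sel q)) := by
  obtain ⟨bottom, top, root, anc, hsel, hbl, htl, hnd, hb, ht, h⟩ :=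
    exists_dirtyUnaryIteration_eq n k hk hkn
  rw [h]
  refine ⟨Circuit.wellFormed_splitIteration hnd hb, fun c i hi => ?_,
    Circuit.pull_splitIteration hnd hb ht, fun w s => ?_⟩
  · have := Circuit.lt_of_op_mem_splitIteration hb c i hi
    rwa [hbl, htl, Nat.sub_add_cancel hkn] at this
  · rw [Circuit.emit_splitIteration hnd hb ht, hsel, List.map_map, lsbVal_map_finRange]
    rfl

theorem mainTheorem9 :
    -- correctness, for every split of the selection register
    (∀ (τ : TreeShape) (n k : ℕ), 1 ≤ k → k ≤ n →
      (dirtyUnaryIteration τ n k).WellFormed ∧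
      (∀ (H : Type u) [NormedAddCommGroup H] [InnerProductSpace ℂ H] (U : ℕ → (H ≃ₗᵢ[ℂ] H)),
        (∀ i < 2 ^ n, U i * U i = 1) →
        (∀ i < 2 ^ n, ∀ j < 2 ^ n, U i * U j = U j * U i) →
        ∀ (ψ : QState (Wire n) H) (s : Wire n → Bool),
          (dirtyUnaryIteration τ n k).run U ψ s =
            U (Nat.ofBits (fun q : Fin n => s (Wire.sel q))) (ψ s)) ∧
      (∀ (w : ℕ) (data : ℕ → Fin w → Bool),
        (dirtyQROM τ n k data).WellFormed ∧
        (dirtyQROM τ n k data).toffoliCount = (dirtyUnaryIteration τ n k).toffoliCount ∧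
        ∀ (ψ : QState (Wire n ⊕ Fin w) ℂ) (s : Wire n ⊕ Fin w → Bool),
          (dirtyQROM τ n k data).run (fun i => i.elim) ψ s =
            ψ (Sum.elim (fun v => s (Sum.inl v))
              (fun r => xor (s (Sum.inr r))
                (data (Nat.ofBits (fun q : Fin n => s (Sum.inl (Wire.sel q)))) r))))) ∧
    -- cost, for every split of the selection register
    (∃ C : ℝ, ∀ (τ : TreeShape) (n k : ℕ), 1 ≤ k → k ≤ n →
      |((dirtyUnaryIteration τ n k).toffoliCount : ℝ) -
          (2 ^ k + 1) * (dirtyReadCost τ (n - k) : ℝ)| ≤ C * (2 ^ k * k)) ∧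
    -- cost, for the split into halves
    (∃ C : ℝ, ∀ n k : ℕ, 1 ≤ k → (k = n / 2 ∨ k = (n + 1) / 2) →
      |((dirtyUnaryIteration .balanced n k).toffoliCount : ℝ) - 1.5 * 2 ^ n| ≤
          C * (n * Real.sqrt (2 ^ n)) ∧
      |((dirtyUnaryIteration .skew n k).toffoliCount : ℝ) - 1.25 * 2 ^ n| ≤
          C * (n * Real.sqrt (2 ^ n))) := by
  refine ⟨fun τ n k hk hkn => ?_, ⟨8, abs_toffoliCount_sub_le⟩, ⟨44, fun n k hk h => ⟨?_, ?_⟩⟩⟩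
  · obtain ⟨hwf, hop, hpull, hemit⟩ := dirtyUnaryIteration_correct τ n k hk hkn
    refine ⟨hwf, fun H _ _ U hU hc ψ s => ?_, fun w data => ⟨?_, ?_, fun ψ s => ?_⟩⟩
    · exact Circuit.run_eq_of_emit_eq U {i | i < 2 ^ n} hU hc _ hop s _ (hpull s)
        (fun w => hemit w s) ψ
    · exact Circuit.wellFormed_flatMap_toQROM data _ hwf
    · exact Circuit.toffoliCount_flatMap_toQROM data _
    · rw [Circuit.run_empty, dirtyQROM]
      conv_lhs => rw [← Sum.elim_comp_inl_inr s]
      rw [Circuit.pull_flatMap_toQROM, hpull]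
      simp only [hemit]
      rfl
  · have hkn : k ≤ n := by omega
    refine abs_split_cost_sub_le hk h (by norm_num) (by norm_num)
      (abs_toffoliCount_sub_le .balanced n k hk hkn) ?_
    rw [dirtyReadCost_eq]
    exact abs_treeCost_balanced_sub_le _
  · have hkn : k ≤ n := by omega
    refine abs_split_cost_sub_le hk h (by norm_num) (by norm_num)
      (abs_toffoliCount_sub_le .skew n k hk hkn) ?_
    rw [dirtyReadCost_eq]
    exact abs_treeCost_skew_sub_le _
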